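/- Let $S$ be a finite set and let $Q=(q_{ij})_{i,j\in S}$ be a generator ($q_{ij}\ge 0$ for $i\ne j$, $\sum_j q_{ij}=0$) that is irreducible, in the sense that $\nu Q=0$, $\sum_{i\in S}\nu_i=1$ has a unique solution $\nu=\pi$. Let $Z=(Z_t)_{t\ge 0}$ be a homogeneous continuous-time Markov chain on $S$ with càdlàg paths, transition matrices $P(t)=e^{tQ}$ and initial law $\mathbb P(Z_0=i)=\pi_i$, $i\in S$. Suppose that $Z$ is exponentially ergodic: for some $c>0$ and all $i\in S$, $e^{ct}\sum_{k\in S}|P(t)_{ik}-\pi_k|\to 0$ as $t\to\infty$. Let $t_j=jh$ with $h=h_n\ge 0$, $nh\to\infty$ and $nh^2\to 0$ as $n\to\infty$, and put $\hat\pi_k=\frac1n\sum_{j=1}^n I_{\{Z_{t_j}=k\}}$. Let $J_1=\inf\{t: Z_t\neq Z_0\}$ be the first jump time and $\tau_{i}=\inf\{t>J_1: Z_t=i\}$ the first return time to $i$ (with $\inf\emptyset=\infty$). Then for all $k\in S$ and all $i_0\in S$ with $\pi_{i_0}>0$ (every $i_0\in S$, if all states communicate), $$\sqrt{nh}\,(\hat\pi_k-\pi_k)\xrightarrow{\mathcal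 L}N(0,V_{\pi_k}),\qquad V_{\pi_k}=2\sum_{i\in S}\big(I_{\{i=k\}}-\pi_k\big)F_i\,\pi_i ,$$ $$F_i=\mathbb E\Big(\int_0^{\tau_{i_0}}\big(I_{\{Z_s=k\}}-\pi_k\big)\,ds\ \Big|\ Z_0=i\Big),$$ where these integrals and expectations are well defined (absolutely convergent) for every $i$ with $\pi_i>0$, the terms with $\pi_i=0$ are read as $0$, and $V_{\pi_k}\ge 0$. -/

import Mathlib

open MeasureTheory ProbabilityTheory Filter Topology
open scoped NNReal ENNReal Matrix

namespace MarkovOccupation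

section Generator

variable {S : Type*} [Fintype S] [DecidableEq S]

/-- `Q` is the generator of a continuous-time Markov chain on the finite set `S`: its
off-diagonal entries are non-negative and its rows sum to zero. -/
structure IsGenerator (Q : Matrix S S ℝ) : Prop where
  nonneg_of_ne : ∀ i j, i ≠ j → 0 ≤ Q i j
  row_sum : ∀ i, ∑ j, Q i j = 0

/-- `ν Q = 0` together with the normalisation `∑ i, ν i = 1`. -/
def IsStationaryLaw (Q : Matrix S S ℝ) (ν : S → ℝ) : Prop :=
  ν ᵥ* Q = 0 ∧ ∑ i, ν i = 1

/-- Irreducibility of a generator: the system `ν Q = 0`, `∑ i, ν i = 1` has a unique solution. -/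
def IsIrreducible (Q : Matrix S S ℝ) : Prop :=
  ∃! ν : S → ℝ, IsStationaryLaw Q ν

/-- The transition matrix `P(t) = exp (t Q)`, i.e. the solution of the Kolmogorov backward equation
`P'(t) = Q P(t)`, `P(0) = 1`. -/
noncomputable def transition (Q : Matrix S S ℝ) (t : ℝ) : Matrix S S ℝ :=
  NormedSpace.exp (t • Q)

/-- The initial condition of the Kolmogorov equation. -/
theorem transition_zero (Q : Matrix S S ℝ) : transition Q 0 = 1 := by
  simp [transition]

/-- The Kolmogorov backward equation, entry by entry. -/
theorem hasDerivAt_transition (Q : Matrix S S ℝ) (t : ℝ) (i j : S) :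
    HasDerivAt (fun u => transition Q u i j) ((Q * transition Q t) i j) t := by
  let _ : NormedRing (Matrix S S ℝ) := Matrix.linftyOpNormedRing
  let _ : NormedAlgebra ℝ (Matrix S S ℝ) := Matrix.linftyOpNormedAlgebra
  have h := hasDerivAt_exp_smul_const' (𝕂 := ℝ) Q t
  have h2 := (hasDerivAt_pi.1 ((hasDerivAt_pi.1 h) i)) j
  exact h2

/-- Exponential ergodicity: for some `c > 0` and every `i`,
`exp (c t) * ∑ k, |P(t) i k - π k| → 0` as `t → ∞`. -/
def IsExponentiallyErgodic (Q : Matrix S S ℝ) (π : S → ℝ) : Prop :=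
  ∃ c : ℝ, 0 < c ∧ ∀ i : S,
    Tendsto (fun t : ℝ => Real.exp (c * t) * ∑ k, |transition Q t i k - π k|) atTop (𝓝 0)

end Generator

section Paths

variable {Ω : Type*} {S : Type*}

/-- `Z` is a homogeneous continuous-time Markov chain, with respect to the filtration `ℱ`, with
finite state space `S`, generator `Q` and càdlàg paths. As `S` is discrete, a path is
right-continuous at `t` if it is constant on some `[t, t + ε)`, and has a left limit at `t` if it is
constant on some `(t - ε, t)`. -/
structure IsMarkovChain [Fintype S] [DecidableEq S] [MeasurableSpace S] {m : MeasurableSpace Ω}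
    (P : Measure Ω) (ℱ : Filtration ℝ≥0 m) (Q : Matrix S S ℝ) (Z : ℝ≥0 → Ω → S) : Prop where
  adapted : ∀ t, Measurable[ℱ t] (Z t)
  right_continuous : ∀ ω t, ∀ᶠ s in 𝓝[>] t, Z s ω = Z t ω
  left_limits : ∀ ω t, ∃ i, ∀ᶠ s in 𝓝[<] t, Z s ω = i
  markov : ∀ (s t : ℝ≥0) (j : S),
    condExp (ℱ s) P ((Z (s + t) ⁻¹' {j}).indicator (fun _ => (1 : ℝ)))
      =ᵐ[P] fun ω => transition Q t (Z s ω) j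

/-- The first jump time `J₁ = inf {t | Z t ≠ Z 0}` (equal to `∞` if the path never jumps). -/
noncomputable def firstJump (Z : ℝ≥0 → Ω → S) (ω : Ω) : ℝ≥0∞ :=
  ⨅ (t : ℝ≥0) (_ : Z t ω ≠ Z 0 ω), (t : ℝ≥0∞)

/-- The first return time `τ_i = inf {t > J₁ | Z t = i}` to the state `i`
(equal to `∞` if there is no such `t`). -/
noncomputable def returnTime (Z : ℝ≥0 → Ω → S) (i : S) (ω : Ω) : ℝ≥0∞ :=
  ⨅ (t : ℝ≥0) (_ : firstJump Z ω < t ∧ Z t ω = i), (t : ℝ≥0∞)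

/-- The time interval `[0, τ_i)` as a set of real numbers. -/
def excursion (Z : ℝ≥0 → Ω → S) (i : S) (ω : Ω) : Set ℝ :=
  {s : ℝ | 0 ≤ s ∧ ENNReal.ofReal s < returnTime Z i ω}

variable [DecidableEq S]

/-- The centred indicator `I{Z_s = k} - π_k` along a path. -/
def centredIndicator (Z : ℝ≥0 → Ω → S) (π : S → ℝ) (k : S) (ω : Ω) (s : ℝ) : ℝ :=
  (if Z s.toNNReal ω = k then 1 else 0) - π k

/-- The random variable `∫_0^{τ_{i₀}} (I{Z_s = k} - π_k) ds`. -/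
noncomputable def excursionIntegral (Z : ℝ≥0 → Ω → S) (π : S → ℝ) (i₀ k : S) (ω : Ω) : ℝ :=
  ∫ s in excursion Z i₀ ω, centredIndicator Z π k ω s

/-- `F_i = E (∫_0^{τ_{i₀}} (I{Z_s = k} - π_k) ds | Z_0 = i)`, the expectation under the conditional
probability given the event `Z_0 = i`. -/
noncomputable def F [MeasurableSpace Ω] (P : Measure Ω) (Z : ℝ≥0 → Ω → S) (π : S → ℝ)
    (i₀ k i : S) : ℝ :=
  ∫ ω, excursionIntegral Z π i₀ k ω ∂(cond P (Z 0 ⁻¹' {i}))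

/-- The asymptotic variance `V_{π_k} = 2 ∑ i, (I{i = k} - π_k) F_i π_i`. -/
noncomputable def asymptoticVariance [Fintype S] [MeasurableSpace Ω] (P : Measure Ω)
    (Z : ℝ≥0 → Ω → S) (π : S → ℝ) (i₀ k : S) : ℝ :=
  2 * ∑ i, ((if i = k then 1 else 0) - π k) * F P Z π i₀ k i * π i

/-- The empirical occupation frequency `n⁻¹ ∑_{j=1}^n I{Z_{t_j} = k}`, with `t_j = j h`. -/
noncomputable def occupationFrequency (Z : ℝ≥0 → Ω → S) (h : ℝ≥0) (n : ℕ) (k : S) (ω : Ω) : ℝ :=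
  (n : ℝ)⁻¹ * ∑ j ∈ Finset.Icc 1 n, (if Z ((j : ℝ≥0) * h) ω = k then 1 else 0)

end Paths

end MarkovOccupation

/-! Write `f` for the centred indicator of `k`. Irreducibility says that the left kernel of `Q` is
spanned by `π`, so by the Fredholm alternative `Q v = w` is solvable whenever `w` has `π`-mean zero.
This gives `G` with `Q G = -f` and, for `μ = ∑ π f G`, a function `H` with `Q H = μ - f G`. The
Dirichlet form of `G` yields `μ ≥ 0`.

Limit law: for the tilted one-step operator `w ↦ P(h) (exp (i b h f) w)`, the function `1 + i b G -
b² H` is an eigenfunction with eigenvalue `1 - b² h μ`, up to an error `O(h |b| (h + b²))`: `G`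
removes the term of order `b`, and `H` makes the term of order `b²` constant
(`exists_norm_tilted_sub_le`). The Markov property iterates this `n` times. With `b = u / √(nh)` the
eigenvalue is `1 - u² μ / n`, the total error vanishes because `nh → ∞` and `nh² → 0`, and the
characteristic functions tend to `exp (-u² μ)`, those of `N(0, 2μ)`.

Variance: normalise `G i₀ = 0`. Dynkin's formula, stopped at the return to `i₀`, gives `F_i = G i`
whenever `0 < π i < 1`, hence `V = 2 μ` (`excursion_expectation`). It is proved on grids of mesh `T
/ 2 ^ n`, so that only the Markov property at deterministic times is needed; right-continuity of
paths carries the result to the limit. Ergodicity serves only to make the return time integrable,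
which supplies the dominating functions. If `π i = 1`, the chain is constant and every integrand
vanishes. -/

namespace MarkovOccupation

/-! ### Generators: Taylor expansion, Fredholm alternative, Dirichlet form. -/

section LinearAlgebra

variable {S : Type*} [Fintype S] [DecidableEq S]

/-- The Kolmogorov forward equation, entry by entry. -/
theorem hasDerivAt_transition_forward (Q : Matrix S S ℝ) (t : ℝ) (i j : S) :
    HasDerivAt (fun u => transition Q u i j) ((transition Q t * Q) i j) t := by
  let _ : NormedRing (Matrix S S ℝ) := Matrix.linftyOpNormedRing
  let _ : NormedAlgebra ℝ (Matrix S S ℝ) := Matrix.linftyOpNormedAlgebra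
  have h := hasDerivAt_exp_smul_const (𝕂 := ℝ) Q t
  have h2 := (hasDerivAt_pi.1 ((hasDerivAt_pi.1 h) i)) j
  exact h2

/-- The rows of the transition matrices of a generator sum to one. -/
theorem sum_transition_eq_one {Q : Matrix S S ℝ} (hQ : IsGenerator Q) (t : ℝ) (i : S) :
    ∑ j, transition Q t i j = 1 := by
  have hd : ∀ u, HasDerivAt (fun u => ∑ j, transition Q u i j) 0 u := by
    intro u
    have h0 : ∑ j, (transition Q u * Q) i j = 0 := by
      simp only [Matrix.mul_apply]
      rw [Finset.sum_comm]
      simp [← Finset.mul_sum, hQ.row_sum]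
    rw [← h0]
    exact HasDerivAt.fun_sum fun j _ => hasDerivAt_transition_forward Q u i j
  have hc := is_const_of_deriv_eq_zero (fun u => (hd u).differentiableAt)
    (fun u => (hd u).deriv) t 0
  refine hc.trans ?_
  simp [transition_zero, Matrix.one_apply]

/-- A stationary law is invariant under the transition matrices. -/
theorem IsStationaryLaw.sum_mul_transition {Q : Matrix S S ℝ} {π : S → ℝ}
    (hπ : IsStationaryLaw Q π) (t : ℝ) (j : S) :
    ∑ i, π i * transition Q t i j = π j := by
  have hd : ∀ u, HasDerivAt (fun u => ∑ i, π i * transition Q u i j) 0 u := by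
    intro u
    have h0 : ∑ i, π i * (Q * transition Q u) i j = 0 := by
      have h1 : (π ᵥ* (Q * transition Q u)) j = 0 := by
        rw [← Matrix.vecMul_vecMul, hπ.1, Matrix.zero_vecMul, Pi.zero_apply]
      exact h1
    rw [← h0]
    exact HasDerivAt.fun_sum fun i _ => (hasDerivAt_transition Q u i j).const_mul _
  refine (is_const_of_deriv_eq_zero (fun u => (hd u).differentiableAt)
    (fun u => (hd u).deriv) t 0).trans ?_
  simp [transition_zero, Matrix.one_apply]

/-- First order Taylor expansion, with quadratic remainder, of the transition matrix at time `0`. -/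
theorem exists_abs_transition_sub_le (Q : Matrix S S ℝ) :
    ∃ C : ℝ, 0 ≤ C ∧ ∀ t ∈ Set.Icc (0 : ℝ) 1, ∀ x y,
      |transition Q t x y - (1 : Matrix S S ℝ) x y - t * Q x y| ≤ C * t ^ 2 := by
  have hcont : ∀ A : Matrix S S ℝ, ∃ M : ℝ, 0 ≤ M ∧ ∀ t ∈ Set.Icc (0 : ℝ) 1, ∀ x y,
      |(A * transition Q t) x y| ≤ M := by
    intro A
    have h1 : ∀ x y, ∃ M : ℝ, ∀ t ∈ Set.Icc (0 : ℝ) 1, |(A * transition Q t) x y| ≤ M := by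
      intro x y
      have hc : Continuous fun t => (A * transition Q t) x y := by
        simp only [Matrix.mul_apply]
        refine continuous_finsetSum _ fun z _ => continuous_const.mul ?_
        exact continuous_iff_continuousAt.2 fun t => (hasDerivAt_transition Q t z y).continuousAt
      obtain ⟨M, hM⟩ := isCompact_Icc.exists_bound_of_continuousOn (s := Set.Icc (0 : ℝ) 1)
        hc.continuousOn
      exact ⟨M, fun t ht => hM t ht⟩
    choose M hM using h1
    refine ⟨∑ x, ∑ y, |M x y|, by positivity, fun t ht x y => (hM x y t ht).trans ?_⟩
    calc M x y ≤ |M x y| := le_abs_self _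
      _ ≤ ∑ y, |M x y| := Finset.single_le_sum (f := fun y => |M x y|)
          (fun _ _ => abs_nonneg _) (Finset.mem_univ y)
      _ ≤ _ := Finset.single_le_sum (f := fun x => ∑ y, |M x y|)
          (fun _ _ => by positivity) (Finset.mem_univ x)
  -- `M` bounds the second derivative `Q² P(t)` on `[0, 1]`; two applications of the mean value
  -- inequality then give the remainder `M t²`.
  obtain ⟨M, hM0, hM⟩ := hcont (Q * Q)
  have hfirst : ∀ t ∈ Set.Icc (0 : ℝ) 1, ∀ x y,
      |(Q * transition Q t) x y - Q x y| ≤ M * t := by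
    intro t ht x y
    have hd : ∀ u, HasDerivAt (fun u => (Q * transition Q u) x y)
        ((Q * Q * transition Q u) x y) u := by
      intro u
      rw [Matrix.mul_assoc, Matrix.mul_apply]
      simp only [Matrix.mul_apply (M := Q)]
      exact HasDerivAt.fun_sum fun z _ => (hasDerivAt_transition Q u z y).const_mul _
    have := (convex_Icc (0 : ℝ) 1).norm_image_sub_le_of_norm_hasDerivWithin_le
      (fun u _ => (hd u).hasDerivWithinAt) (fun u hu => hM u hu x y)
      (Set.left_mem_Icc.2 zero_le_one) ht
    simpa [transition_zero, abs_of_nonneg ht.1] using this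
  refine ⟨M, hM0, fun t ht x y => ?_⟩
  have hd : ∀ u, HasDerivAt (fun u => transition Q u x y - u * Q x y)
      ((Q * transition Q u) x y - Q x y) u := fun u =>
    (hasDerivAt_transition Q u x y).sub (by simpa using (hasDerivAt_id u).mul_const (Q x y))
  have := (convex_Icc (0 : ℝ) t).norm_image_sub_le_of_norm_hasDerivWithin_le (C := M * t)
    (fun u _ => (hd u).hasDerivWithinAt)
    (fun u hu => (hfirst u ⟨hu.1, hu.2.trans ht.2⟩ x y).trans
      (mul_le_mul_of_nonneg_left hu.2 hM0))
    (Set.left_mem_Icc.2 ht.1) (Set.right_mem_Icc.2 ht.1)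
  simp only [transition_zero, Real.norm_eq_abs, sub_zero, zero_mul, abs_of_nonneg ht.1] at this
  calc _ = |transition Q t x y - t * Q x y - (1 : Matrix S S ℝ) x y| := by
        congr 1; ring
    _ ≤ M * t * t := this
    _ = M * t ^ 2 := by ring

theorem exists_abs_transition_mulVec_sub_le (Q : Matrix S S ℝ) (w : S → ℝ) :
    ∃ C : ℝ, 0 ≤ C ∧ ∀ t ∈ Set.Icc (0 : ℝ) 1, ∀ x,
      |(transition Q t *ᵥ w) x - w x - t * (Q *ᵥ w) x| ≤ C * t ^ 2 := by
  obtain ⟨C, hC0, hC⟩ := exists_abs_transition_sub_le Q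
  refine ⟨C * ∑ y, |w y|, by positivity, fun t ht x => ?_⟩
  have h1 : (transition Q t *ᵥ w) x - w x - t * (Q *ᵥ w) x
      = ∑ y, (transition Q t x y - (1 : Matrix S S ℝ) x y - t * Q x y) * w y := by
    simp only [Matrix.mulVec, dotProduct, sub_mul, Finset.sum_sub_distrib, Finset.mul_sum,
      Matrix.one_apply, ite_mul, one_mul, zero_mul, mul_assoc]
    simp
  rw [h1, mul_right_comm, Finset.mul_sum]
  refine (Finset.abs_sum_le_sum_abs _ _).trans (Finset.sum_le_sum fun y _ => ?_)
  rw [abs_mul]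
  exact mul_le_mul_of_nonneg_right (hC t ht x y) (abs_nonneg _)

/-- The Fredholm alternative for an irreducible generator. -/
theorem exists_mulVec_eq_of_dotProduct_eq_zero {Q : Matrix S S ℝ} {π : S → ℝ}
    (hirr : IsIrreducible Q) (hπ : IsStationaryLaw Q π) {w : S → ℝ} (hw : π ⬝ᵥ w = 0) :
    ∃ g, Q *ᵥ g = w := by
  by_contra hne
  have hmem : w ∉ LinearMap.range Q.mulVecLin := by
    rintro ⟨g, hg⟩
    exact hne ⟨g, hg⟩
  -- A functional that separates `w` from the range of `Q` is represented by a left null vector `ν`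
  -- of `Q`.
  obtain ⟨φ, hφw, hφ⟩ := Submodule.exists_le_ker_of_notMem hmem
  set ν : S → ℝ := fun i => φ (Pi.single i 1) with hν
  have hφν : ∀ v, φ v = ν ⬝ᵥ v := by
    intro v
    conv_lhs => rw [← Finset.univ_sum_single v]
    rw [map_sum]
    refine Finset.sum_congr rfl fun i _ => ?_
    rw [show (Pi.single i (v i) : S → ℝ) = v i • Pi.single i 1 by
      rw [← Pi.single_smul]; simp, map_smul, smul_eq_mul, mul_comm]
  have hνQ : ν ᵥ* Q = 0 := by
    funext j
    have : φ (Q *ᵥ Pi.single j 1) = 0 := hφ ⟨Pi.single j 1, rfl⟩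
    rw [hφν, Matrix.dotProduct_mulVec] at this
    simpa using this
  obtain ⟨π', -, huniq⟩ := hirr
  -- Adding a multiple of `π` normalises `ν` even when its total mass is zero. Uniqueness then makes
  -- `ν` a multiple of `π`, which annihilates `w`.
  have h1 : IsStationaryLaw Q (ν + (1 - ∑ i, ν i) • π) := by
    refine ⟨?_, ?_⟩
    · rw [Matrix.add_vecMul, Matrix.smul_vecMul, hνQ, hπ.1]; simp
    · simp [Finset.sum_add_distrib, ← Finset.mul_sum, hπ.2]
  have h2 : ν + (1 - ∑ i, ν i) • π = π := (huniq _ h1).trans (huniq _ hπ).symm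
  apply hφw
  have h3 : ν = (∑ i, ν i) • π := by
    funext i
    have := congrFun h2 i
    simp only [Pi.add_apply, Pi.smul_apply, smul_eq_mul] at this ⊢
    linarith
  rw [hφν, h3, smul_dotProduct, hw, smul_zero]

/-- Non-negativity of the Dirichlet form of a generator with respect to a stationary law. -/
theorem sum_mul_mul_mulVec_nonpos {Q : Matrix S S ℝ} {π : S → ℝ} (hQ : IsGenerator Q)
    (hπ : IsStationaryLaw Q π) (hπ0 : ∀ i, 0 ≤ π i) (g : S → ℝ) :
    ∑ i, π i * g i * (Q *ᵥ g) i ≤ 0 := by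
  have h0 : 0 ≤ ∑ i, ∑ j, π i * Q i j * (g i - g j) ^ 2 := by
    refine Finset.sum_nonneg fun i _ => Finset.sum_nonneg fun j _ => ?_
    by_cases hij : i = j
    · simp [hij]
    · exact mul_nonneg (mul_nonneg (hπ0 i) (hQ.nonneg_of_ne i j hij)) (sq_nonneg _)
  have h1 : ∑ i, ∑ j, π i * Q i j * g i ^ 2 = 0 := by
    refine Finset.sum_eq_zero fun i _ => ?_
    rw [← Finset.sum_mul, ← Finset.mul_sum, hQ.row_sum]; simp
  have h2 : ∑ i, ∑ j, π i * Q i j * g j ^ 2 = 0 := by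
    rw [Finset.sum_comm]
    refine Finset.sum_eq_zero fun j _ => ?_
    rw [← Finset.sum_mul]
    have := congrFun hπ.1 j
    simp only [Matrix.vecMul, dotProduct, Pi.zero_apply] at this
    rw [this, zero_mul]
  have h3 : ∑ i, ∑ j, π i * Q i j * (g i - g j) ^ 2
      = ∑ i, ∑ j, π i * Q i j * g i ^ 2 - 2 * ∑ i, π i * g i * (Q *ᵥ g) i
        + ∑ i, ∑ j, π i * Q i j * g j ^ 2 := by
    simp only [Matrix.mulVec, dotProduct, Finset.mul_sum]
    rw [← Finset.sum_sub_distrib, ← Finset.sum_add_distrib]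
    refine Finset.sum_congr rfl fun i _ => ?_
    rw [← Finset.sum_sub_distrib, ← Finset.sum_add_distrib]
    refine Finset.sum_congr rfl fun j _ => ?_
    ring
  linarith

end LinearAlgebra

/-! ### The Markov property in integrated form. -/

section MarkovProperty

variable {Ω : Type*} {m : MeasurableSpace Ω} {P : Measure Ω}
  {ℱ : Filtration ℝ≥0 m} {S : Type*} [Fintype S] [DecidableEq S] [MeasurableSpace S]
  {Q : Matrix S S ℝ} {Z : ℝ≥0 → Ω → S}

theorem IsMarkovChain.measurable (hZ : IsMarkovChain P ℱ Q Z) (t : ℝ≥0) : Measurable (Z t) :=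
  (hZ.adapted t).mono (ℱ.le t) le_rfl

theorem IsMarkovChain.measurable_of_le (hZ : IsMarkovChain P ℱ Q Z) {s t : ℝ≥0} (hst : s ≤ t) :
    Measurable[ℱ t] (Z s) :=
  (hZ.adapted s).mono (ℱ.mono hst) le_rfl

variable [IsProbabilityMeasure P] [MeasurableSingletonClass S]

/-- The Markov property tested against a bounded random variable that is measurable with respect
to the past. -/
theorem IsMarkovChain.integral_ite_smul {E : Type*} [NormedAddCommGroup E] [NormedSpace ℝ E]
    [CompleteSpace E] (hZ : IsMarkovChain P ℱ Q Z) (s t : ℝ≥0) (j : S) {W : Ω → E}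
    (hW : StronglyMeasurable[ℱ s] W) {C : ℝ} (hC : ∀ ω, ‖W ω‖ ≤ C) :
    ∫ ω, (if Z (s + t) ω = j then (1 : ℝ) else 0) • W ω ∂P
      = ∫ ω, transition Q t (Z s ω) j • W ω ∂P := by
  set B : E →L[ℝ] ℝ →L[ℝ] E := (ContinuousLinearMap.lsmul ℝ ℝ).flip
  have hB : ∀ (w : E) (r : ℝ), B w r = r • w := fun w r => rfl
  set g : Ω → ℝ := (Z (s + t) ⁻¹' {j}).indicator (fun _ => (1 : ℝ))
  have hgdef : ∀ ω, g ω = if Z (s + t) ω = j then 1 else 0 := fun ω => by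
    by_cases h : Z (s + t) ω = j <;> simp [g, h]
  have hgm : MeasurableSet (Z (s + t) ⁻¹' {j}) := hZ.measurable _ (measurableSet_singleton j)
  have hg : Integrable g P := (integrable_const 1).indicator hgm
  have hWm : StronglyMeasurable W := hW.mono (ℱ.le s)
  have hint : Integrable (fun ω => B (W ω) (g ω)) P := by
    refine Integrable.of_bound (C := C) ?_ (ae_of_all _ fun ω => ?_)
    · exact (hg.aestronglyMeasurable.smul hWm.aestronglyMeasurable)
    · rw [hB, hgdef, norm_smul]
      have h1 := hC ω
      have h2 := norm_nonneg (W ω)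
      split_ifs
      · simpa using h1
      · simpa using h2.trans h1
  have h1 := condExp_bilin_of_stronglyMeasurable_left (μ := P) (m := ℱ s) B hW hint hg
  calc ∫ ω, (if Z (s + t) ω = j then (1 : ℝ) else 0) • W ω ∂P
      = ∫ ω, B (W ω) (g ω) ∂P := by simp only [hB, hgdef]
    _ = ∫ ω, (P[fun ω => B (W ω) (g ω) | ℱ s]) ω ∂P := (integral_condExp (ℱ.le s)).symm
    _ = _ := by
      refine integral_congr_ae ?_
      filter_upwards [h1, hZ.markov s t j] with ω hω1 hω2
      rw [hω1, hω2, hB]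

/-- Summing over the values of the chain reduces this to indicators. `W` will be the product of the
Fourier factors observed so far. -/
theorem IsMarkovChain.integral_mul (hZ : IsMarkovChain P ℱ Q Z) (s t : ℝ≥0) (g : S → ℂ)
    {W : Ω → ℂ} (hW : StronglyMeasurable[ℱ s] W) {C : ℝ} (hC : ∀ ω, ‖W ω‖ ≤ C) :
    ∫ ω, W ω * g (Z (s + t) ω) ∂P
      = ∫ ω, W ω * ∑ j, (transition Q t (Z s ω) j : ℂ) * g j ∂P := by
  have hWm : StronglyMeasurable W := hW.mono (ℱ.le s)
  have hint : ∀ (j : S) (c : S → ℝ) (u : ℝ≥0), Integrable (fun ω => c (Z u ω) • (g j * W ω)) P := by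
    intro j c u
    refine Integrable.of_bound (C := (∑ x, |c x|) * (‖g j‖ * C)) ?_ (ae_of_all _ fun ω => ?_)
    · exact ((measurable_of_finite c).comp (hZ.measurable u)).aestronglyMeasurable.smul
        (hWm.const_mul _).aestronglyMeasurable
    · rw [norm_smul, norm_mul, Real.norm_eq_abs]
      have := Finset.single_le_sum (f := fun x => |c x|) (fun _ _ => abs_nonneg _)
        (Finset.mem_univ (Z u ω))
      gcongr
      exact hC ω
  calc ∫ ω, W ω * g (Z (s + t) ω) ∂P
      = ∫ ω, ∑ j, (if Z (s + t) ω = j then (1 : ℝ) else 0) • (g j * W ω) ∂P := by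
        refine integral_congr_ae (ae_of_all _ fun ω => ?_)
        simp [mul_comm]
    _ = ∑ j, ∫ ω, (if Z (s + t) ω = j then (1 : ℝ) else 0) • (g j * W ω) ∂P :=
        integral_finsetSum _ fun j _ => hint j (fun x => if x = j then 1 else 0) (s + t)
    _ = ∑ j, ∫ ω, transition Q t (Z s ω) j • (g j * W ω) ∂P := by
        refine Finset.sum_congr rfl fun j _ => ?_
        refine hZ.integral_ite_smul s t j (hW.const_mul _) (C := ‖g j‖ * C) fun ω => ?_
        rw [norm_mul]
        exact mul_le_mul_of_nonneg_left (hC ω) (norm_nonneg _)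
    _ = ∫ ω, ∑ j, transition Q t (Z s ω) j • (g j * W ω) ∂P :=
        (integral_finsetSum _ fun j _ => hint j (fun x => transition Q t x j) s).symm
    _ = _ := by
        refine integral_congr_ae (ae_of_all _ fun ω => ?_)
        simp only [Finset.mul_sum, Complex.real_smul]
        exact Finset.sum_congr rfl fun j _ => by ring

theorem IsMarkovChain.integrable_comp (hZ : IsMarkovChain P ℱ Q Z) (g : S → ℝ) (t : ℝ≥0) :
    Integrable (fun ω => g (Z t ω)) P := by
  refine Integrable.of_bound (C := ∑ x, |g x|) ?_ (ae_of_all _ fun ω => ?_)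
  · exact ((measurable_of_finite g).comp (hZ.measurable t)).aestronglyMeasurable
  · exact Finset.single_le_sum (f := fun x => |g x|) (fun _ _ => abs_nonneg _)
        (Finset.mem_univ (Z t ω))

theorem IsMarkovChain.setIntegral_comp (hZ : IsMarkovChain P ℱ Q Z) (s t : ℝ≥0) (g : S → ℝ)
    {A : Set Ω} (hA : MeasurableSet[ℱ s] A) :
    ∫ ω in A, g (Z (s + t) ω) ∂P = ∫ ω in A, (transition Q t *ᵥ g) (Z s ω) ∂P := by
  have h := hZ.integral_mul s t (fun x => (g x : ℂ)) (W := A.indicator fun _ => 1)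
    (stronglyMeasurable_const.indicator hA) (C := 1) (fun ω => by
      by_cases hω : ω ∈ A <;> simp [hω])
  have hA' := ℱ.le s _ hA
  have e : ∀ φ : Ω → ℝ, ∫ ω, A.indicator (fun _ => (1 : ℂ)) ω * (φ ω : ℂ) ∂P
      = ((∫ ω in A, φ ω ∂P : ℝ) : ℂ) := by
    intro φ
    rw [← integral_complex_ofReal, ← integral_indicator hA']
    congr 1
    funext ω
    by_cases hω : ω ∈ A <;> simp [hω]
  have h2 : ∀ ω, ∑ j, (transition Q t (Z s ω) j : ℂ) * (g j : ℂ)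
      = (((transition Q t *ᵥ g) (Z s ω) : ℝ) : ℂ) := by
    intro ω
    simp [Matrix.mulVec, dotProduct]
  simp only [h2, e] at h
  exact_mod_cast h

end MarkovProperty

/-! ### Approximate eigenfunction of the tilted operator. -/

section OneStep

variable {S : Type*}

/-- The approximate eigenfunction `1 + i b G - b² H` of the tilted transition operator. -/
noncomputable def correctedOne (G H : S → ℝ) (b : ℝ) (x : S) : ℂ :=
  1 + Complex.I * b * G x - b ^ 2 * H x

/-- The Fourier factor `exp (i b h f)`. -/
noncomputable def fourierFactor (f : S → ℝ) (b h : ℝ) (x : S) : ℂ :=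
  Complex.exp (Complex.I * (b * h * f x : ℝ))

theorem exists_abs_le_of_finite [Fintype S] (w : S → ℝ) : ∃ M : ℝ, 0 ≤ M ∧ ∀ x, |w x| ≤ M :=
  ⟨∑ x, |w x|, by positivity, fun x => Finset.single_le_sum (f := fun x => |w x|)
    (fun _ _ => abs_nonneg _) (Finset.mem_univ x)⟩

theorem norm_correctedOne_sub_one_le {G H : S → ℝ} {M b : ℝ}
    (hG : ∀ x, |G x| ≤ M) (hH : ∀ x, |H x| ≤ M) (hb : |b| ≤ 1) (x : S) :
    ‖correctedOne G H b x - 1‖ ≤ 2 * M * |b| := by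
  have h1 : correctedOne G H b x - 1 = Complex.I * b * G x - b ^ 2 * H x := by
    simp only [correctedOne]; ring
  rw [h1]
  refine (norm_sub_le _ _).trans ?_
  simp only [norm_mul, norm_pow, Complex.norm_I, Complex.norm_real, Real.norm_eq_abs, one_mul]
  have h2 : |b| ^ 2 ≤ |b| := by nlinarith [abs_nonneg b]
  calc |b| * |G x| + |b| ^ 2 * |H x| ≤ |b| * M + |b| * M := by
        gcongr
        exacts [hG x, hH x]
    _ = _ := by ring

variable [Fintype S] [DecidableEq S]

theorem exists_abs_transition_mulVec_sub_self_le (Q : Matrix S S ℝ) (w : S → ℝ) :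
    ∃ C : ℝ, 0 ≤ C ∧ ∀ t ∈ Set.Icc (0 : ℝ) 1, ∀ x,
      |(transition Q t *ᵥ w) x - w x| ≤ C * t := by
  obtain ⟨C, hC0, hC⟩ := exists_abs_transition_mulVec_sub_le Q w
  obtain ⟨M, hM0, hM⟩ := exists_abs_le_of_finite (Q *ᵥ w)
  refine ⟨C + M, by positivity, fun t ht x => ?_⟩
  have h1 := hC t ht x
  have h2 : |t * (Q *ᵥ w) x| ≤ t * M := by
    rw [abs_mul, abs_of_nonneg ht.1]
    exact mul_le_mul_of_nonneg_left (hM x) ht.1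
  have h3 : t ^ 2 ≤ t := by nlinarith [ht.1, ht.2]
  calc |(transition Q t *ᵥ w) x - w x|
      = |((transition Q t *ᵥ w) x - w x - t * (Q *ᵥ w) x) + t * (Q *ᵥ w) x| := by
        congr 1; ring
    _ ≤ _ := abs_add_le _ _
    _ ≤ C * t ^ 2 + t * M := add_le_add h1 h2
    _ ≤ (C + M) * t := by nlinarith

theorem exists_sum_abs_transition_le (Q : Matrix S S ℝ) :
    ∃ B : ℝ, 0 ≤ B ∧ ∀ t ∈ Set.Icc (0 : ℝ) 1, ∀ x, ∑ y, |transition Q t x y| ≤ B := by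
  obtain ⟨C, hC0, hC⟩ := exists_abs_transition_sub_le Q
  refine ⟨∑ x, ∑ y, (C + |(1 : Matrix S S ℝ) x y| + |Q x y|), by positivity, fun t ht x => ?_⟩
  refine le_trans (Finset.sum_le_sum fun y _ => ?_) (Finset.single_le_sum
    (f := fun x => ∑ y, (C + |(1 : Matrix S S ℝ) x y| + |Q x y|))
    (fun _ _ => by positivity) (Finset.mem_univ x))
  have h1 := hC t ht x y
  have h2 : |t * Q x y| ≤ |Q x y| := by
    rw [abs_mul, abs_of_nonneg ht.1]
    exact mul_le_of_le_one_left (abs_nonneg _) ht.2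
  have h3 : C * t ^ 2 ≤ C := mul_le_of_le_one_right hC0 (pow_le_one₀ ht.1 ht.2)
  calc |transition Q t x y|
      = |(transition Q t x y - (1 : Matrix S S ℝ) x y - t * Q x y) + (1 : Matrix S S ℝ) x y
          + t * Q x y| := by congr 1; ring
    _ ≤ _ := abs_add_three _ _ _
    _ ≤ _ := by linarith

/-- One step of the tilted chain: `1 + i b G - b² H` is an eigenfunction up to an error of smaller
order, with eigenvalue `1 - b² h μ`. -/
theorem exists_norm_tilted_sub_le {Q : Matrix S S ℝ} (hQ : IsGenerator Q) {f G H : S → ℝ} {μ : ℝ}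
    (hf : ∀ x, |f x| ≤ 1) (hG : Q *ᵥ G = fun x => - f x)
    (hH : Q *ᵥ H = fun x => μ - f x * G x) :
    ∃ C : ℝ, 0 ≤ C ∧ ∀ h ∈ Set.Icc (0 : ℝ) 1, ∀ b : ℝ, |b| ≤ 1 → ∀ x,
      ‖∑ y, (transition Q h x y : ℂ) * (fourierFactor f b h y * correctedOne G H b y)
        - (1 - b ^ 2 * h * μ : ℝ) * correctedOne G H b x‖ ≤ C * (h * |b| * (h + b ^ 2)) := by
  obtain ⟨MG, hMG0, hMG⟩ := exists_abs_le_of_finite G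
  obtain ⟨MH, hMH0, hMH⟩ := exists_abs_le_of_finite H
  obtain ⟨B, hB0, hB⟩ := exists_sum_abs_transition_le Q
  obtain ⟨C1, hC10, hC1⟩ := exists_abs_transition_mulVec_sub_le Q G
  obtain ⟨C2, hC20, hC2⟩ := exists_abs_transition_mulVec_sub_le Q H
  obtain ⟨C3, hC30, hC3⟩ := exists_abs_transition_mulVec_sub_self_le Q f
  obtain ⟨C4, hC40, hC4⟩ := exists_abs_transition_mulVec_sub_self_le Q (fun x => f x * G x)
  set M := max MG MH
  have hM0 : 0 ≤ M := hMG0.trans (le_max_left _ _)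
  have hGM : ∀ x, |G x| ≤ M := fun x => (hMG x).trans (le_max_left _ _)
  have hHM : ∀ x, |H x| ≤ M := fun x => (hMH x).trans (le_max_right _ _)
  refine ⟨C1 + C2 + C3 + C4 + B * (1 + 3 * M) + 2 * M * |μ|, by positivity,
    fun h hh b hb x => ?_⟩
  obtain ⟨hh0, hh1⟩ := hh
  have hb0 := abs_nonneg b
  have hbsq : |b| ^ 2 = b ^ 2 := sq_abs b
  set e := h * |b| * (h + b ^ 2) with he
  have he0 : 0 ≤ e := by positivity
  -- All errors below have one of the orders `|b| h²`, `b² h²`, `|b|³ h`, and each of these is at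
  -- most `e`.
  have hbh : |b| * h ^ 2 ≤ e := by
    have : 0 ≤ h * |b| * b ^ 2 := by positivity
    rw [he]; nlinarith
  have hb2h : b ^ 2 * h ^ 2 ≤ e := by
    refine le_trans ?_ hbh
    rw [← hbsq]
    have : |b| ^ 2 ≤ |b| := by nlinarith
    gcongr
  have hb3 : |b| ^ 3 * h ≤ e := by
    have h1 : 0 ≤ h * |b| * h := by positivity
    have h2 : |b| ^ 3 * h = h * |b| * b ^ 2 := by rw [← hbsq]; ring
    rw [he, h2]; nlinarith
  set K := transition Q h with hK
  -- the remainder of the Fourier factor times the approximate eigenfunction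
  set R : S → ℂ := fun y => fourierFactor f b h y * correctedOne G H b y
    - (1 + Complex.I * b * G y - b ^ 2 * H y + Complex.I * b * h * f y
      - b ^ 2 * h * (f y * G y)) with hR
  have hRle : ∀ y, ‖R y‖ ≤ (1 + 3 * M) * e := by
    intro y
    -- The product of `i b h f` with `i b G` is `-b² h f G`, a main term. What remains is the
    -- quadratic remainder of the exponential and one cubic term.
    have hRy : R y = (fourierFactor f b h y - 1 - Complex.I * (b * h * f y : ℝ))
        * correctedOne G H b y - Complex.I * (b : ℂ) ^ 3 * h * f y * H y := by
      have hI : Complex.I ^ 2 = -1 := Complex.I_sq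
      simp only [hR, correctedOne]
      push_cast
      linear_combination (b ^ 2 * h * f y * G y : ℂ) * hI
    have hθ : ‖Complex.I * (b * h * f y : ℝ)‖ ≤ |b| * h := by
      rw [norm_mul, Complex.norm_I, one_mul, Complex.norm_real, Real.norm_eq_abs, abs_mul, abs_mul,
        abs_of_nonneg hh0]
      exact mul_le_of_le_one_right (by positivity) (hf y)
    have hθ1 : |b| * h ≤ 1 := mul_le_one₀ hb hh0 hh1
    have h1 : ‖fourierFactor f b h y - 1 - Complex.I * (b * h * f y : ℝ)‖ ≤ b ^ 2 * h ^ 2 := by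
      refine (Complex.norm_exp_sub_one_sub_id_le (hθ.trans hθ1)).trans ?_
      rw [← hbsq, ← mul_pow]
      gcongr
    have h2 : ‖correctedOne G H b y‖ ≤ 1 + 2 * M := by
      have h3 := norm_correctedOne_sub_one_le hGM hHM hb y
      have h4 : ‖correctedOne G H b y‖ ≤ ‖correctedOne G H b y - 1‖ + ‖(1 : ℂ)‖ := by
        simpa using norm_add_le (correctedOne G H b y - 1) 1
      rw [norm_one] at h4
      have : 2 * M * |b| ≤ 2 * M := mul_le_of_le_one_right (by positivity) hb
      linarith
    have h3 : ‖Complex.I * (b : ℂ) ^ 3 * h * f y * H y‖ ≤ M * e := by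
      simp only [norm_mul, norm_pow, Complex.norm_I, Complex.norm_real, Real.norm_eq_abs, one_mul,
        abs_of_nonneg hh0]
      calc |b| ^ 3 * h * |f y| * |H y| ≤ |b| ^ 3 * h * 1 * M := by
            gcongr
            exacts [hf y, hHM y]
        _ ≤ M * e := by nlinarith
    rw [hRy]
    calc _ ≤ _ := norm_sub_le _ _
      _ ≤ (b ^ 2 * h ^ 2) * (1 + 2 * M) + M * e := by
          rw [norm_mul]
          gcongr
      _ ≤ e * (1 + 2 * M) + M * e := by gcongr
      _ = _ := by ring
  have hKR : ‖∑ y, (K x y : ℂ) * R y‖ ≤ B * ((1 + 3 * M) * e) := by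
    calc _ ≤ ∑ y, ‖(K x y : ℂ) * R y‖ := norm_sum_le _ _
      _ ≤ ∑ y, |K x y| * ((1 + 3 * M) * e) := by
          refine Finset.sum_le_sum fun y _ => ?_
          rw [norm_mul, Complex.norm_real, Real.norm_eq_abs]
          exact mul_le_mul_of_nonneg_left (hRle y) (abs_nonneg _)
      _ = (∑ y, |K x y|) * ((1 + 3 * M) * e) := by rw [Finset.sum_mul]
      _ ≤ _ := mul_le_mul_of_nonneg_right (hB h ⟨hh0, hh1⟩ x) (by positivity)
  have hone : ∑ y, (K x y : ℂ) = 1 := by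
    have := sum_transition_eq_one hQ h x
    exact_mod_cast this
  have hlin : ∀ w : S → ℝ, ∑ y, (K x y : ℂ) * (w y : ℂ) = (((K *ᵥ w) x : ℝ) : ℂ) := by
    intro w
    simp [Matrix.mulVec, dotProduct]
  have r1 := hC1 h ⟨hh0, hh1⟩ x
  have r2 := hC2 h ⟨hh0, hh1⟩ x
  have r3 := hC3 h ⟨hh0, hh1⟩ x
  have r4 := hC4 h ⟨hh0, hh1⟩ x
  rw [hG] at r1
  rw [hH] at r2
  simp only at r1 r2 r4
  rw [← hK] at r1 r2 r3 r4
  set q1 := (K *ᵥ G) x - G x - h * -f x with hq1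
  set q2 := (K *ᵥ H) x - H x - h * (μ - f x * G x) with hq2
  set q3 := (K *ᵥ f) x - f x with hq3
  set q4 := (K *ᵥ fun y => f y * G y) x - f x * G x with hq4
  have hsum : ∑ y, (K x y : ℂ) * (fourierFactor f b h y * correctedOne G H b y)
      = 1 + Complex.I * b * (((K *ᵥ G) x : ℝ) : ℂ) - b ^ 2 * (((K *ᵥ H) x : ℝ) : ℂ)
        + Complex.I * b * h * (((K *ᵥ f) x : ℝ) : ℂ)
        - b ^ 2 * h * (((K *ᵥ fun y => f y * G y) x : ℝ) : ℂ) + ∑ y, (K x y : ℂ) * R y := by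
    rw [← hone, ← hlin G, ← hlin H, ← hlin f, ← hlin fun y => f y * G y]
    simp only [Finset.mul_sum]
    rw [← Finset.sum_add_distrib, ← Finset.sum_sub_distrib, ← Finset.sum_add_distrib,
      ← Finset.sum_sub_distrib, ← Finset.sum_add_distrib]
    refine Finset.sum_congr rfl fun y _ => ?_
    simp only [hR]
    push_cast
    ring
  -- The two Poisson equations act here: `-i b h f` from `K G` cancels the Fourier term, and `b² h f
  -- G` from `K H` cancels the cross term, leaving `-b² h μ`. The last summand arises because the
  -- eigenvalue multiplies the whole eigenfunction and not just `1`.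
  have hdiff : ∑ y, (K x y : ℂ) * (fourierFactor f b h y * correctedOne G H b y)
        - (1 - b ^ 2 * h * μ : ℝ) * correctedOne G H b x
      = Complex.I * b * q1 - b ^ 2 * q2 + Complex.I * b * h * q3 - b ^ 2 * h * q4
        + ∑ y, (K x y : ℂ) * R y + b ^ 2 * h * μ * (correctedOne G H b x - 1) := by
    rw [hsum, hq1, hq2, hq3, hq4]
    simp only [correctedOne]
    push_cast
    ring
  rw [hdiff]
  have t1 : ‖Complex.I * b * q1‖ ≤ C1 * e := by
    simp only [norm_mul, Complex.norm_I, Complex.norm_real, Real.norm_eq_abs, one_mul]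
    calc |b| * |q1| ≤ |b| * (C1 * h ^ 2) := by gcongr
      _ = C1 * (|b| * h ^ 2) := by ring
      _ ≤ _ := by gcongr
  have t2 : ‖(b : ℂ) ^ 2 * q2‖ ≤ C2 * e := by
    simp only [norm_mul, norm_pow, Complex.norm_real, Real.norm_eq_abs, hbsq]
    calc b ^ 2 * |q2| ≤ b ^ 2 * (C2 * h ^ 2) := by gcongr
      _ = C2 * (b ^ 2 * h ^ 2) := by ring
      _ ≤ _ := by gcongr
  have t3 : ‖Complex.I * b * h * q3‖ ≤ C3 * e := by
    simp only [norm_mul, Complex.norm_I, Complex.norm_real, Real.norm_eq_abs, one_mul,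
      abs_of_nonneg hh0]
    calc |b| * h * |q3| ≤ |b| * h * (C3 * h) := by gcongr
      _ = C3 * (|b| * h ^ 2) := by ring
      _ ≤ _ := by gcongr
  have t4 : ‖(b : ℂ) ^ 2 * h * q4‖ ≤ C4 * e := by
    simp only [norm_mul, norm_pow, Complex.norm_real, Real.norm_eq_abs, hbsq, abs_of_nonneg hh0]
    calc b ^ 2 * h * |q4| ≤ b ^ 2 * h * (C4 * h) := by gcongr
      _ = C4 * (b ^ 2 * h ^ 2) := by ring
      _ ≤ _ := by gcongr
  have t5 : ‖(b : ℂ) ^ 2 * h * μ * (correctedOne G H b x - 1)‖ ≤ 2 * M * |μ| * e := by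
    simp only [norm_mul, norm_pow, Complex.norm_real, Real.norm_eq_abs, abs_of_nonneg hh0]
    calc |b| ^ 2 * h * |μ| * ‖correctedOne G H b x - 1‖
        ≤ |b| ^ 2 * h * |μ| * (2 * M * |b|) := by
          gcongr
          exact norm_correctedOne_sub_one_le hGM hHM hb x
      _ = 2 * M * |μ| * (|b| ^ 3 * h) := by ring
      _ ≤ _ := by gcongr
  calc _ ≤ ‖Complex.I * b * q1‖ + ‖(b : ℂ) ^ 2 * q2‖ + ‖Complex.I * b * h * q3‖
        + ‖(b : ℂ) ^ 2 * h * q4‖ + ‖∑ y, (K x y : ℂ) * R y‖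
        + ‖(b : ℂ) ^ 2 * h * μ * (correctedOne G H b x - 1)‖ := by
        refine (norm_add_le _ _).trans (add_le_add_left ?_ _)
        refine (norm_add_le _ _).trans (add_le_add_left ?_ _)
        refine (norm_sub_le _ _).trans (add_le_add_left ?_ _)
        refine (norm_add_le _ _).trans (add_le_add_left ?_ _)
        exact norm_sub_le _ _
    _ ≤ _ := by linarith

end OneStep

/-- Multiplication by `l` does not amplify earlier errors, so they add up linearly. -/
theorem norm_sub_pow_mul_le {a : ℕ → ℂ} {l : ℂ} {e : ℝ} (hl : ‖l‖ ≤ 1)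
    (ha : ∀ n, ‖a (n + 1) - l * a n‖ ≤ e) (n : ℕ) : ‖a n - l ^ n * a 0‖ ≤ n * e := by
  induction n with
  | zero => simp
  | succ n ih =>
    have h1 : a (n + 1) - l ^ (n + 1) * a 0 = (a (n + 1) - l * a n) + l * (a n - l ^ n * a 0) := by
      ring
    rw [h1]
    refine (norm_add_le _ _).trans ?_
    rw [norm_mul]
    have h2 : ‖l‖ * ‖a n - l ^ n * a 0‖ ≤ ‖a n - l ^ n * a 0‖ :=
      mul_le_of_le_one_left (norm_nonneg _) hl
    push_cast
    linarith [ha n]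

/-! ### Convergence of characteristic functions. -/

section CharFun

variable {Ω : Type*} {S : Type*} {Z : ℝ≥0 → Ω → S}

/-- The product of the Fourier factors along the first `n` observations. -/
noncomputable def fourierProd (Z : ℝ≥0 → Ω → S) (f : S → ℝ) (b : ℝ) (h : ℝ≥0) (n : ℕ) (ω : Ω) : ℂ :=
  ∏ j ∈ Finset.Icc 1 n, fourierFactor f b h (Z (j * h) ω)

theorem fourierProd_succ (f : S → ℝ) (b : ℝ) (h : ℝ≥0) (n : ℕ) (ω : Ω) :
    fourierProd Z f b h (n + 1) ω
      = fourierProd Z f b h n ω * fourierFactor f b h (Z (n * h + h) ω) := by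
  rw [fourierProd, Finset.prod_Icc_succ_top (by omega), fourierProd]
  congr 3
  push_cast
  ring_nf

theorem norm_fourierFactor (f : S → ℝ) (b h : ℝ) (x : S) : ‖fourierFactor f b h x‖ = 1 := by
  rw [fourierFactor, mul_comm, Complex.norm_exp_ofReal_mul_I]

theorem norm_fourierProd (f : S → ℝ) (b : ℝ) (h : ℝ≥0) (n : ℕ) (ω : Ω) :
    ‖fourierProd Z f b h n ω‖ = 1 := by
  simp [fourierProd, norm_prod, norm_fourierFactor]

variable {m : MeasurableSpace Ω} {P : Measure Ω} {ℱ : Filtration ℝ≥0 m} [Fintype S]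
  [DecidableEq S] [MeasurableSpace S] [MeasurableSingletonClass S] {Q : Matrix S S ℝ}

theorem IsMarkovChain.stronglyMeasurable_fourierProd (hZ : IsMarkovChain P ℱ Q Z)
    (f : S → ℝ) (b : ℝ) (h : ℝ≥0) (n : ℕ) :
    StronglyMeasurable[ℱ (n * h)] (fourierProd Z f b h n) := by
  refine Measurable.stronglyMeasurable ?_
  refine Finset.measurable_fun_prod _ fun j hj => ?_
  refine (measurable_of_finite (fourierFactor f b h)).comp ?_
  refine (hZ.adapted _).mono (ℱ.mono ?_) le_rfl
  have : (j : ℝ≥0) ≤ n := by exact_mod_cast (Finset.mem_Icc.1 hj).2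
  gcongr

variable [IsProbabilityMeasure P]

/-- Quantitative comparison of the characteristic function of the occupation time with a power. -/
theorem IsMarkovChain.exists_norm_integral_fourierProd_sub_le (hZ : IsMarkovChain P ℱ Q Z)
    (hQ : IsGenerator Q) {f G H : S → ℝ} {μ : ℝ} (hf : ∀ x, |f x| ≤ 1)
    (hG : Q *ᵥ G = fun x => - f x) (hH : Q *ᵥ H = fun x => μ - f x * G x) (hμ : 0 ≤ μ) :
    ∃ C : ℝ, 0 ≤ C ∧ ∀ h : ℝ≥0, h ≤ 1 → ∀ b : ℝ, |b| ≤ 1 → b ^ 2 * h * μ ≤ 1 → ∀ n : ℕ,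
      ‖∫ ω, fourierProd Z f b h n ω ∂P - ((1 - b ^ 2 * h * μ : ℝ) : ℂ) ^ n‖
        ≤ C * (|b| + n * (h * |b| * (h + b ^ 2))) := by
  obtain ⟨C, hC0, hC⟩ := exists_norm_tilted_sub_le hQ hf hG hH
  obtain ⟨MG, hMG0, hMG⟩ := exists_abs_le_of_finite G
  obtain ⟨MH, hMH0, hMH⟩ := exists_abs_le_of_finite H
  set M := max MG MH
  have hM0 : 0 ≤ M := hMG0.trans (le_max_left _ _)
  have hGM : ∀ x, |G x| ≤ M := fun x => (hMG x).trans (le_max_left _ _)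
  have hHM : ∀ x, |H x| ≤ M := fun x => (hMH x).trans (le_max_right _ _)
  -- `C` is the one-step error; `4 * M` pays twice, at times `n` and `0`, for replacing the
  -- eigenfunction by `1`.
  refine ⟨C + 4 * M, by positivity, fun h hh b hb hbμ n => ?_⟩
  set v := correctedOne G H b with hv
  set l : ℝ := 1 - b ^ 2 * h * μ with hl
  set e : ℝ := h * |b| * (h + b ^ 2) with he
  have he0 : 0 ≤ e := by positivity
  have hl0 : 0 ≤ l := by linarith
  have hl1 : l ≤ 1 := by
    have : 0 ≤ b ^ 2 * h * μ := by positivity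
    linarith
  have hln : ‖(l : ℂ)‖ ≤ 1 := by
    rw [Complex.norm_real, Real.norm_eq_abs, abs_of_nonneg hl0]; exact hl1
  have hv1 : ∀ x, ‖v x - 1‖ ≤ 2 * M * |b| := norm_correctedOne_sub_one_le hGM hHM hb
  have hWm : ∀ j, StronglyMeasurable (fourierProd Z f b h j) := fun j =>
    (hZ.stronglyMeasurable_fourierProd f b h j).mono (ℱ.le _)
  have hint : ∀ (j : ℕ) (u : ℝ≥0) (g : S → ℂ), Integrable (fun ω => fourierProd Z f b h j ω *
      g (Z u ω)) P := by
    intro j u g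
    refine Integrable.of_bound (C := ∑ x, ‖g x‖) ?_ (ae_of_all _ fun ω => ?_)
    · exact (hWm j).aestronglyMeasurable.mul
        ((measurable_of_finite g).comp (hZ.measurable u)).aestronglyMeasurable
    · rw [norm_mul, norm_fourierProd, one_mul]
      exact Finset.single_le_sum (f := fun x => ‖g x‖) (fun _ _ => norm_nonneg _)
        (Finset.mem_univ (Z u ω))
  set a : ℕ → ℂ := fun j => ∫ ω, fourierProd Z f b h j ω * v (Z (j * h) ω) ∂P with ha
  have hstep : ∀ j, ‖a (j + 1) - l * a j‖ ≤ C * e := by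
    intro j
    have h1 : a (j + 1) = ∫ ω, fourierProd Z f b h j ω *
        ∑ y, (transition Q h (Z (j * h) ω) y : ℂ) * (fourierFactor f b h y * v y) ∂P := by
      rw [← hZ.integral_mul (j * h) h (fun y => fourierFactor f b h y * v y)
        (hZ.stronglyMeasurable_fourierProd f b h j) (fun ω => (norm_fourierProd f b h j ω).le)]
      refine integral_congr_ae (ae_of_all _ fun ω => ?_)
      have e1 : ((j + 1 : ℕ) : ℝ≥0) * h = j * h + h := by push_cast; ring
      simp only [fourierProd_succ, e1, mul_assoc]
    rw [h1, ha]
    simp only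
    rw [← integral_const_mul, ← integral_sub (hint j (j * h) fun x =>
      ∑ y, (transition Q h x y : ℂ) * (fourierFactor f b h y * v y))
      ((hint j (j * h) v).const_mul _)]
    refine (norm_integral_le_of_norm_le_const (C := C * e) (ae_of_all _ fun ω => ?_)).trans ?_
    · rw [show ∀ p q r : ℂ, p * q - l * (p * r) = p * (q - l * r) by intros; ring,
        norm_mul, norm_fourierProd, one_mul]
      exact hC h ⟨h.2, by exact_mod_cast hh⟩ b hb _
    · simp
  have h1 := norm_sub_pow_mul_le hln hstep n
  have hclose : ∀ (j : ℕ) , ‖∫ ω, fourierProd Z f b h j ω ∂P - a j‖ ≤ 2 * M * |b| := by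
    intro j
    rw [ha]
    simp only
    rw [← integral_sub (by simpa using hint j 0 (fun _ => 1)) (hint j _ v)]
    refine (norm_integral_le_of_norm_le_const (C := 2 * M * |b|) (ae_of_all _ fun ω => ?_)).trans ?_
    · rw [show ∀ p q : ℂ, p - p * q = p * (1 - q) by intros; ring,
        norm_mul, norm_fourierProd, one_mul, norm_sub_rev]
      exact hv1 _
    · simp
  have h2 := hclose n
  have h3 := hclose 0
  have h4 : ∫ ω, fourierProd Z f b h 0 ω ∂P = 1 := by simp [fourierProd]
  rw [h4] at h3
  have h5 : ‖(l : ℂ) ^ n * (a 0 - 1)‖ ≤ 2 * M * |b| := by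
    rw [norm_mul, norm_pow, norm_sub_rev]
    exact (mul_le_of_le_one_left (norm_nonneg _) (pow_le_one₀ (norm_nonneg _) hln)).trans h3
  calc _ = ‖(∫ ω, fourierProd Z f b h n ω ∂P - a n) + (a n - (l : ℂ) ^ n * a 0)
        + (l : ℂ) ^ n * (a 0 - 1)‖ := by congr 1; ring
    _ ≤ 2 * M * |b| + n * (C * e) + 2 * M * |b| :=
        (norm_add_le _ _).trans (add_le_add ((norm_add_le _ _).trans (add_le_add h2 h1)) h5)
    _ ≤ (C + 4 * M) * (|b| + n * e) := by
        have : 0 ≤ C * |b| := by positivity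
        have : 0 ≤ M * (n * e) := by positivity
        nlinarith

/-- Pointwise convergence of the characteristic functions of the normalised occupation times. -/
theorem IsMarkovChain.tendsto_integral_fourierProd (hZ : IsMarkovChain P ℱ Q Z)
    (hQ : IsGenerator Q) {f G H : S → ℝ} {μ : ℝ} (hf : ∀ x, |f x| ≤ 1)
    (hG : Q *ᵥ G = fun x => - f x) (hH : Q *ᵥ H = fun x => μ - f x * G x) (hμ : 0 ≤ μ)
    {h : ℕ → ℝ≥0} (hT : Tendsto (fun n : ℕ => (n : ℝ) * (h n : ℝ)) atTop atTop)
    (hh : Tendsto (fun n : ℕ => (n : ℝ) * (h n : ℝ) ^ 2) atTop (𝓝 0)) (u : ℝ) :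
    Tendsto (fun n : ℕ => ∫ ω, fourierProd Z f (u / √(n * h n)) (h n) n ω ∂P) atTop
      (𝓝 (Complex.exp (-(u ^ 2 * μ : ℝ)))) := by
  obtain ⟨C, hC0, hC⟩ := hZ.exists_norm_integral_fourierProd_sub_le hQ hf hG hH hμ
  set s : ℕ → ℝ := fun n => √(n * h n) with hs
  have hsT : Tendsto s atTop atTop := Real.tendsto_sqrt_atTop.comp hT
  have hsinv : Tendsto (fun n => (s n)⁻¹) atTop (𝓝 0) := tendsto_inv_atTop_zero.comp hsT
  have hb0 : Tendsto (fun n => |u / s n|) atTop (𝓝 0) := by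
    simpa [div_eq_mul_inv] using (hsinv.const_mul u).abs
  -- `h` is the product of `n h²` and `(n h)⁻¹`.
  have hh0 : Tendsto (fun n => (h n : ℝ)) atTop (𝓝 0) := by
    have h1 := hh.mul (tendsto_inv_atTop_zero.comp hT)
    rw [zero_mul] at h1
    refine h1.congr' ?_
    filter_upwards [hT.eventually_gt_atTop 0] with n hn
    simp only [Function.comp]
    rw [show (n : ℝ) * (h n : ℝ) ^ 2 = h n * (n * h n) by ring, mul_assoc, mul_inv_cancel₀ hn.ne',
      mul_one]
  have hpow : Tendsto (fun n : ℕ => ((1 - (u / s n) ^ 2 * h n * μ : ℝ) : ℂ) ^ n) atTop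
      (𝓝 (Complex.exp (-(u ^ 2 * μ : ℝ)))) := by
    refine (Complex.tendsto_one_add_div_pow_exp (-(u ^ 2 * μ : ℝ))).congr' ?_
    filter_upwards [hT.eventually_gt_atTop 0] with n hn
    have hn0 : (n : ℝ) ≠ 0 := fun h0 => by simp [h0] at hn
    have hhn0 : (h n : ℝ) ≠ 0 := fun h0 => by simp [h0] at hn
    have e1 : (u / s n) ^ 2 * h n * μ = u ^ 2 * μ / n := by
      rw [div_pow, hs, Real.sq_sqrt hn.le]
      field_simp
    rw [e1]
    push_cast
    ring
  have herr : Tendsto (fun n : ℕ => C * (|u / s n| +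
      n * (h n * |u / s n| * (h n + (u / s n) ^ 2)))) atTop (𝓝 0) := by
    -- Since `s² = n h`, the accumulated error is exactly `|u| (n h² + u²) / s`.
    have h1 : Tendsto (fun n : ℕ => C * (|u / s n| +
        |u| * (n * (h n : ℝ) ^ 2 * (s n)⁻¹ + u ^ 2 * (s n)⁻¹))) atTop
        (𝓝 (C * (0 + |u| * (0 * 0 + u ^ 2 * 0)))) :=
      (hb0.add (((hh.mul hsinv).add (hsinv.const_mul _)).const_mul _)).const_mul _
    simp only [mul_zero, add_zero] at h1
    refine h1.congr' ?_
    filter_upwards [hT.eventually_gt_atTop 0] with n hn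
    have hs0 : 0 < s n := Real.sqrt_pos.2 hn
    have hsq : s n ^ 2 = n * h n := Real.sq_sqrt hn.le
    rw [abs_div, abs_of_pos hs0]
    congr 2
    field_simp
    linear_combination |u| * u ^ 2 * hsq
  have hdiff : Tendsto (fun n : ℕ => ∫ ω, fourierProd Z f (u / s n) (h n) n ω ∂P
      - ((1 - (u / s n) ^ 2 * h n * μ : ℝ) : ℂ) ^ n) atTop (𝓝 0) := by
    refine squeeze_zero_norm' ?_ herr
    have h2 : Tendsto (fun n => (u / s n) ^ 2 * h n * μ) atTop (𝓝 0) := by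
      have := ((hb0.pow 2).mul hh0).mul_const μ
      simpa [sq_abs] using this
    filter_upwards [hh0.eventually_lt_const one_pos, hb0.eventually_lt_const one_pos,
      h2.eventually_lt_const one_pos] with n h3 h4 h5
    exact hC (h n) (by exact_mod_cast h3.le) _ h4.le h5.le n
  have h3 := hdiff.add hpow
  simp only [sub_add_cancel, zero_add] at h3
  exact h3

end CharFun

/-! ### Central limit theorem with variance `2 μ`. -/

section CentralLimit

variable {Ω : Type*} {m : MeasurableSpace Ω} {P : Measure Ω} [IsProbabilityMeasure P]
  {ℱ : Filtration ℝ≥0 m} {S : Type*} [Fintype S] [DecidableEq S] [MeasurableSpace S]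
  [MeasurableSingletonClass S] {Q : Matrix S S ℝ} {Z : ℝ≥0 → Ω → S}

/-- The central limit theorem for the occupation frequencies, with the variance expressed through
solutions of Poisson equations. -/
theorem IsMarkovChain.tendstoInDistribution_occupationFrequency (hZ : IsMarkovChain P ℱ Q Z)
    (hQ : IsGenerator Q) {π G H : S → ℝ} {μ : ℝ} {k : S}
    (hf : ∀ x, |(if x = k then 1 else 0) - π k| ≤ 1)
    (hG : Q *ᵥ G = fun x => - ((if x = k then 1 else 0) - π k))
    (hH : Q *ᵥ H = fun x => μ - ((if x = k then 1 else 0) - π k) * G x) (hμ : 0 ≤ μ)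
    {h : ℕ → ℝ≥0} (hT : Tendsto (fun n : ℕ => (n : ℝ) * (h n : ℝ)) atTop atTop)
    (hh : Tendsto (fun n : ℕ => (n : ℝ) * (h n : ℝ) ^ 2) atTop (𝓝 0)) :
    TendstoInDistribution
      (fun (n : ℕ) (ω : Ω) => √((n : ℝ) * (h n : ℝ)) *
        (occupationFrequency Z (h n) n k ω - π k))
      atTop (id : ℝ → ℝ) (fun _ => P) (gaussianReal 0 (2 * μ).toNNReal) := by
  have hmeas : ∀ n : ℕ, Measurable (fun ω : Ω => √((n : ℝ) * (h n : ℝ)) *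
      (occupationFrequency Z (h n) n k ω - π k)) := by
    intro n
    refine ((Measurable.const_mul ?_ _).sub_const _).const_mul _
    exact Finset.measurable_fun_sum _ fun j _ =>
      (measurable_of_finite fun x => if x = k then (1 : ℝ) else 0).comp (hZ.measurable _)
  refine ⟨fun n => (hmeas n).aemeasurable, aemeasurable_id, ?_⟩
  refine ProbabilityMeasure.tendsto_iff_tendsto_charFun.2 fun u => ?_
  have h1 := hZ.tendsto_integral_fourierProd hQ hf hG hH hμ hT hh u
  simp only [ProbabilityMeasure.coe_mk, Measure.map_id, charFun_gaussianReal]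
  have e : Complex.exp (u * (0 : ℝ) * Complex.I - ((2 * μ).toNNReal : ℝ) * u ^ 2 / 2)
      = Complex.exp (-(u ^ 2 * μ : ℝ)) := by
    rw [Real.coe_toNNReal _ (by positivity)]
    congr 1
    push_cast
    ring
  rw [e]
  refine h1.congr' ?_
  filter_upwards [hT.eventually_gt_atTop 0] with n hn
  rw [charFun_apply_real, integral_map (hmeas n).aemeasurable (by fun_prop)]
  refine integral_congr_ae (ae_of_all _ fun ω => ?_)
  simp only [fourierProd, fourierFactor]
  rw [← Complex.exp_sum, ← Finset.mul_sum, mul_comm, ← Complex.ofReal_sum, ← Finset.mul_sum,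
    Finset.sum_sub_distrib, ← Complex.ofReal_mul]
  congr 3
  have hn0 : (n : ℝ) ≠ 0 := fun h0 => by simp [h0] at hn
  have hs0 : 0 < √((n : ℝ) * h n) := Real.sqrt_pos.2 hn
  have hsq : √((n : ℝ) * h n) ^ 2 = n * h n := Real.sq_sqrt hn.le
  simp only [Finset.sum_const, Nat.card_Icc, add_tsub_cancel_right, nsmul_eq_mul,
    occupationFrequency]
  rw [div_mul_eq_mul_div, div_mul_eq_mul_div, div_eq_iff hs0.ne']
  generalize √((n : ℝ) * h n) = r at hsq
  generalize (∑ j ∈ Finset.Icc 1 n, if Z (j * h n) ω = k then (1 : ℝ) else 0) = X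
  have e2 : (n : ℝ)⁻¹ * n = 1 := inv_mul_cancel₀ hn0
  linear_combination (-u * (X * (n : ℝ)⁻¹ - π k)) * hsq - u * h n * X * e2

end CentralLimit

/-! ### Time grids and step functions. -/

section Grid

/-- The first point of the grid `ε ℕ` strictly after `s`. -/
noncomputable def gridAbove (ε s : ℝ≥0) : ℝ≥0 := ((⌊s / ε⌋₊ + 1 : ℕ) : ℝ≥0) * ε

theorem lt_gridAbove {ε : ℝ≥0} (hε : 0 < ε) (s : ℝ≥0) : s < gridAbove ε s := by
  have := Nat.lt_floor_add_one (s / ε)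
  rw [div_lt_iff₀ hε] at this
  simpa [gridAbove] using this

theorem floor_mul_le {ε : ℝ≥0} (hε : 0 < ε) (s : ℝ≥0) : (⌊s / ε⌋₊ : ℝ≥0) * ε ≤ s := by
  have := Nat.floor_le (zero_le (a := s / ε))
  rwa [le_div_iff₀ hε] at this

theorem gridAbove_le {ε : ℝ≥0} (hε : 0 < ε) (s : ℝ≥0) : gridAbove ε s ≤ s + ε := by
  have := floor_mul_le hε s
  simp only [gridAbove, Nat.cast_add, Nat.cast_one, add_mul, one_mul]
  gcongr

theorem tendsto_gridAbove {ε : ℕ → ℝ≥0} (hε : ∀ n, 0 < ε n) (hε0 : Tendsto ε atTop (𝓝 0))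
    (s : ℝ≥0) : Tendsto (fun n => gridAbove (ε n) s) atTop (𝓝[>] s) := by
  refine tendsto_nhdsWithin_iff.2 ⟨?_, Eventually.of_forall fun n => lt_gridAbove (hε n) s⟩
  have h1 : Tendsto (fun n => s + ε n) atTop (𝓝 s) := by simpa using hε0.const_add s
  exact tendsto_of_tendsto_of_tendsto_of_le_of_le tendsto_const_nhds h1
    (fun n => (lt_gridAbove (hε n) s).le) (fun n => gridAbove_le (hε n) s)

/-- The integral of a step function on the grid `ε ℕ`. -/
theorem integrable_integral_step {ε : ℝ≥0} (hε : 0 < ε) (c : ℕ → ℝ) (N : ℕ) :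
    IntegrableOn (fun s : ℝ => c ⌊s.toNNReal / ε⌋₊) (Set.Ico 0 (N * ε : ℝ)) ∧
      ∫ s in Set.Ico 0 (N * ε : ℝ), c ⌊s.toNNReal / ε⌋₊ = ∑ j ∈ Finset.range N, ε * c j := by
  induction N with
  | zero => simp
  | succ N ih =>
    have hε' : (0 : ℝ) < ε := hε
    have hN : (0 : ℝ) ≤ N * ε := by positivity
    have hle : (N * ε : ℝ) ≤ (N + 1 : ℕ) * ε := by push_cast; nlinarith
    have hconst : Set.EqOn (fun s : ℝ => c ⌊s.toNNReal / ε⌋₊) (fun _ => c N)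
        (Set.Ico (N * ε : ℝ) ((N + 1 : ℕ) * ε)) := by
      intro s hs
      have hs0 : 0 ≤ s := hN.trans hs.1
      have : ⌊s.toNNReal / ε⌋₊ = N := by
        rw [Nat.floor_eq_iff zero_le, le_div_iff₀ hε, div_lt_iff₀ hε]
        constructor
        · rw [← NNReal.coe_le_coe]; simpa [hs0] using hs.1
        · rw [← NNReal.coe_lt_coe]; simpa [hs0] using hs.2
      simp [this]
    have hI : IntegrableOn (fun s : ℝ => c ⌊s.toNNReal / ε⌋₊)
        (Set.Ico (N * ε : ℝ) ((N + 1 : ℕ) * ε)) :=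
      (integrableOn_congr_fun hconst measurableSet_Ico).2 (integrableOn_const (by simp))
    have hU : Set.Ico (0 : ℝ) ((N + 1 : ℕ) * ε)
        = Set.Ico 0 (N * ε : ℝ) ∪ Set.Ico (N * ε : ℝ) ((N + 1 : ℕ) * ε) :=
      (Set.Ico_union_Ico_eq_Ico hN hle).symm
    rw [hU]
    refine ⟨ih.1.union hI, ?_⟩
    rw [setIntegral_union (Set.Ico_disjoint_Ico_same) measurableSet_Ico ih.1 hI, ih.2,
      setIntegral_congr_fun measurableSet_Ico hconst, Finset.sum_range_succ]
    simp only [integral_const, MeasurableSet.univ, measureReal_restrict_apply, Set.univ_inter,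
      Real.volume_real_Ico_of_le hle, smul_eq_mul]
    push_cast
    ring

end Grid

/-! ### Survival before the return, observed on a grid. -/

section Unreturned

variable {Ω : Type*} {S : Type*}

/-- The event that the path observed on the grid `ε ℕ` up to the index `j` has not been seen in
`i₀` at or after a grid time at which it was seen to have left its initial state. -/
def unreturned (Z : ℝ≥0 → Ω → S) (i₀ : S) (ε : ℝ≥0) (j : ℕ) : Set Ω :=
  {ω | ∀ l p : ℕ, l ≤ p → p ≤ j → Z (l * ε) ω ≠ Z 0 ω → Z (p * ε) ω ≠ i₀}

variable {Z : ℝ≥0 → Ω → S} {i₀ : S}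

theorem unreturned_antitone (ε : ℝ≥0) : Antitone (unreturned Z i₀ ε) :=
  fun _ _ hij _ hω l p hlp hpi => hω l p hlp (hpi.trans hij)

theorem unreturned_zero (ε : ℝ≥0) : unreturned Z i₀ ε 0 = Set.univ := by
  ext ω
  simp only [unreturned, Set.mem_ofPred_eq, Set.mem_univ, iff_true]
  intro l p hl hp h
  obtain rfl : p = 0 := by omega
  obtain rfl : l = 0 := by omega
  simp at h

/-- The only new constraint at index `j + 1` is the one with `p = j + 1`, so its failure locates the
chain at `i₀`. -/
theorem eq_of_mem_unreturned_of_notMem {ε : ℝ≥0} {j : ℕ} {ω : Ω} (h1 : ω ∈ unreturned Z i₀ ε j)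
    (h2 : ω ∉ unreturned Z i₀ ε (j + 1)) : Z ((j + 1 : ℕ) * ε) ω = i₀ := by
  simp only [unreturned, Set.mem_ofPred_eq, not_forall, not_not] at h2
  obtain ⟨l, p, hlp, hp, hl, hpi⟩ := h2
  rcases Nat.lt_or_ge j p with h | h
  · obtain rfl : p = j + 1 := by omega
    exact hpi
  · exact absurd hpi (h1 l p hlp h hl)

/-- The coarse grid is contained in the fine one, so a return seen on the coarse grid is also seen
on the fine one. This gives bounds uniform in `n`. -/
theorem unreturned_refine_subset (T : ℝ≥0) (n j : ℕ) :
    unreturned Z i₀ (T / 2 ^ n) j ⊆ unreturned Z i₀ T (j / 2 ^ n) := by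
  intro ω hω l p hlp hp hl
  have e : ∀ q : ℕ, ((q * 2 ^ n : ℕ) : ℝ≥0) * (T / 2 ^ n) = q * T := by
    intro q
    push_cast
    field_simp
  have := hω (l * 2 ^ n) (p * 2 ^ n) (Nat.mul_le_mul_right _ hlp)
    ((Nat.le_div_iff_mul_le (by positivity)).1 hp)
  rw [e, e] at this
  exact this hl

/-- The number of grid times before the return is observed. -/
noncomputable def lifetime (Z : ℝ≥0 → Ω → S) (i₀ : S) (ε : ℝ≥0) (ω : Ω) : ℝ≥0∞ :=
  ∑' j, (unreturned Z i₀ ε j).indicator (fun _ => 1) ω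

theorem add_one_le_lifetime {ε : ℝ≥0} {j : ℕ} {ω : Ω} (h : ω ∈ unreturned Z i₀ ε j)
    (hL : lifetime Z i₀ ε ω ≠ ⊤) : (j + 1 : ℝ) ≤ (lifetime Z i₀ ε ω).toReal := by
  have h1 : ((j + 1 : ℕ) : ℝ≥0∞) ≤ lifetime Z i₀ ε ω := by
    calc ((j + 1 : ℕ) : ℝ≥0∞)
        = ∑ l ∈ Finset.range (j + 1), (unreturned Z i₀ ε l).indicator (fun _ => (1 : ℝ≥0∞)) ω := by
          rw [Finset.sum_congr rfl fun l hl => Set.indicator_of_mem (unreturned_antitone ε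
            (Nat.lt_succ_iff.1 (Finset.mem_range.1 hl)) h) _]
          simp
      _ ≤ _ := ENNReal.sum_le_tsum _
  have h2 := ENNReal.toReal_mono hL h1
  rw [ENNReal.toReal_natCast] at h2
  exact_mod_cast h2

end Unreturned

/-! ### Pathwise discretisation of the excursion integral. -/

section Pathwise

variable {Ω : Type*} {S : Type*} {Z : ℝ≥0 → Ω → S} {i₀ : S} {ω : Ω}

/-- The time `b` may itself be the first jump time, which the strict inequality in `returnTime`
excludes. By right-continuity the path is still in `i₀` just after `b`, and the infimum absorbs the
shift. -/
theorem returnTime_le_of_right_continuous (hr : ∀ t, ∀ᶠ s in 𝓝[>] t, Z s ω = Z t ω) {a b : ℝ≥0}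
    (ha : Z a ω ≠ Z 0 ω) (hab : a ≤ b) (hb : Z b ω = i₀) : returnTime Z i₀ ω ≤ b := by
  by_contra! hlt
  have h1 : ∀ᶠ u : ℝ≥0 in 𝓝[>] b, (u : ℝ≥0∞) < returnTime Z i₀ ω :=
    nhdsWithin_le_nhds (ENNReal.continuous_coe.continuousAt.eventually_lt_const hlt)
  obtain ⟨u, hu1, hu2, hu3⟩ := (h1.and ((hr b).and self_mem_nhdsWithin)).exists
  refine absurd hu1 (not_lt.2 (iInf₂_le u ⟨?_, hu2.trans hb⟩))
  have h2 : firstJump Z ω ≤ a := iInf₂_le a ha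
  refine h2.trans_lt ?_
  exact_mod_cast hab.trans_lt hu3

theorem mem_unreturned_of_lt_returnTime (hr : ∀ t, ∀ᶠ s in 𝓝[>] t, Z s ω = Z t ω) {ε s : ℝ≥0}
    (hε : 0 < ε) (hs : (s : ℝ≥0∞) < returnTime Z i₀ ω) : ω ∈ unreturned Z i₀ ε ⌊s / ε⌋₊ := by
  intro l p hlp hp hl hpi
  have h1 : (l : ℝ≥0) * ε ≤ p * ε := by gcongr
  have h2 : (p : ℝ≥0) * ε ≤ s := by
    refine le_trans ?_ (floor_mul_le hε s)
    gcongr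
  refine absurd hs (not_lt.2 ((returnTime_le_of_right_continuous hr hl h1 hpi).trans ?_))
  exact_mod_cast h2

/-- Take `a < t < s` with the path away from its initial state at `a` and in `i₀` at `t`. By
right-continuity, grid points just after `a` and `t` show the same values once the mesh is small. -/
theorem eventually_notMem_unreturned (hr : ∀ t, ∀ᶠ s in 𝓝[>] t, Z s ω = Z t ω) {ε : ℕ → ℝ≥0}
    (hε : ∀ n, 0 < ε n) (hε0 : Tendsto ε atTop (𝓝 0)) {s : ℝ≥0}
    (hs : returnTime Z i₀ ω < s) : ∀ᶠ n in atTop, ω ∉ unreturned Z i₀ (ε n) ⌊s / ε n⌋₊ := by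
  simp only [returnTime, iInf_lt_iff] at hs
  obtain ⟨t, ⟨htJ, hti⟩, hts⟩ := hs
  simp only [firstJump, iInf_lt_iff] at htJ
  obtain ⟨a, haZ, hat⟩ := htJ
  have hts' : t < s := by exact_mod_cast hts
  have hat' : a ≤ t := by exact_mod_cast hat.le
  filter_upwards [(tendsto_gridAbove hε hε0 a).eventually (hr a),
    (tendsto_gridAbove hε hε0 t).eventually (hr t),
    (tendsto_nhds_of_tendsto_nhdsWithin (tendsto_gridAbove hε hε0 t)).eventually_lt_const hts']
    with n h1 h2 h3 hω
  refine hω (⌊a / ε n⌋₊ + 1) (⌊t / ε n⌋₊ + 1) ?_ ?_ ?_ ?_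
  · gcongr
  · rw [Nat.le_floor_iff zero_le, le_div_iff₀ (hε n)]
    exact h3.le
  · exact fun h => haZ (h1.symm.trans h)
  · exact h2.trans hti

theorem measurableSet_excursion (Z : ℝ≥0 → Ω → S) (i₀ : S) (ω : Ω) :
    MeasurableSet (excursion Z i₀ ω) :=
  measurableSet_Ici.inter (measurableSet_lt ENNReal.measurable_ofReal measurable_const)

/-- The discretised excursion integral. -/
noncomputable def gridIntegral (Z : ℝ≥0 → Ω → S) (f : S → ℝ) (i₀ : S) (ε : ℝ≥0) (N : ℕ) (ω : Ω) :
    ℝ :=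
  ∑ j ∈ Finset.range N, ε * (unreturned Z i₀ ε j).indicator (fun ω => f (Z ((j + 1 : ℕ) * ε) ω)) ω

/-- Along a path whose return is observed on the grid `T ℕ`, the excursion integral is absolutely
convergent, and it is the limit of its discretisations. -/
theorem excursion_integral_of_lifetime_ne_top (hr : ∀ t, ∀ᶠ s in 𝓝[>] t, Z s ω = Z t ω) {T : ℝ≥0}
    (hT : 0 < T) (hL : lifetime Z i₀ T ω ≠ ⊤) {f : S → ℝ} (hf : ∀ x, |f x| ≤ 1) :
    IntegrableOn (fun s : ℝ => f (Z s.toNNReal ω)) (excursion Z i₀ ω) ∧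
      Tendsto (fun n : ℕ => gridIntegral Z f i₀ (T / 2 ^ n) (n * 2 ^ n) ω) atTop
        (𝓝 (∫ s in excursion Z i₀ ω, f (Z s.toNNReal ω))) ∧
      ∀ n : ℕ, |gridIntegral Z f i₀ (T / 2 ^ n) (n * 2 ^ n) ω|
        ≤ (lifetime Z i₀ T ω).toReal * T := by
  set ε : ℕ → ℝ≥0 := fun n => T / 2 ^ n with hεdef
  have hε : ∀ n, 0 < ε n := fun n => by positivity
  have hε0 : Tendsto ε atTop (𝓝 0) := by
    have := (NNReal.tendsto_pow_atTop_nhds_zero_of_lt_one (r := (2⁻¹ : ℝ≥0)) (by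
      rw [← NNReal.coe_lt_coe]; norm_num)).const_mul T
    simpa [hεdef, div_eq_mul_inv] using this
  set D : ℝ := (lifetime Z i₀ T ω).toReal with hD
  set c : ℕ → ℕ → ℝ := fun n j =>
    (unreturned Z i₀ (ε n) j).indicator (fun ω => f (Z ((j + 1 : ℕ) * ε n) ω)) ω with hc
  set φ : ℕ → ℝ → ℝ := fun n => (Set.Ico 0 ((n * 2 ^ n : ℕ) * ε n : ℝ)).indicator
    fun s => c n ⌊s.toNNReal / ε n⌋₊ with hφ
  set g : ℝ → ℝ := (excursion Z i₀ ω).indicator fun s => f (Z s.toNNReal ω) with hg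
  have hφint : ∀ n, ∫ s, φ n s = gridIntegral Z f i₀ (ε n) (n * 2 ^ n) ω := by
    intro n
    rw [hφ]
    simp only
    rw [integral_indicator measurableSet_Ico, (integrable_integral_step (hε n) (c n) _).2]
    rfl
  have hφm : ∀ n, AEStronglyMeasurable (φ n) := by
    intro n
    refine (Measurable.indicator ?_ measurableSet_Ico).aestronglyMeasurable
    exact (measurable_of_countable (c n)).comp
      (Nat.measurable_floor.comp (measurable_real_toNNReal.div_const _))
  have hφle : ∀ n s, ‖φ n s‖ ≤ (Set.Icc 0 (D * T : ℝ)).indicator (fun _ => (1 : ℝ)) s := by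
    intro n s
    have hnn : 0 ≤ (Set.Icc 0 (D * T : ℝ)).indicator (fun _ => (1 : ℝ)) s :=
      Set.indicator_nonneg (fun _ _ => zero_le_one) _
    by_cases hs : s ∈ Set.Ico 0 ((n * 2 ^ n : ℕ) * ε n : ℝ)
    swap
    · simp only [hφ, Set.indicator_of_notMem hs, norm_zero]; exact hnn
    simp only [hφ, Set.indicator_of_mem hs, hc]
    by_cases hu : ω ∈ unreturned Z i₀ (ε n) ⌊s.toNNReal / ε n⌋₊
    swap
    · simp only [Set.indicator_of_notMem hu, norm_zero]; exact hnn
    -- Survival on the fine grid forces survival on the coarse grid at index `q`, so `q + 1 ≤ D`,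
    -- which confines `s` to `[0, D T]` independently of `n`.
    have h1 := add_one_le_lifetime (unreturned_refine_subset T n _ hu) hL
    set q := ⌊s.toNNReal / ε n⌋₊ / 2 ^ n with hq
    have h2 : s ≤ D * T := by
      have h3 := lt_gridAbove (hε n) s.toNNReal
      have h4 : ⌊s.toNNReal / ε n⌋₊ + 1 ≤ (q + 1) * 2 ^ n := by
        have := Nat.lt_mul_div_succ ⌊s.toNNReal / ε n⌋₊ (show 0 < 2 ^ n by positivity)
        rw [mul_comm]
        exact this
      have h5 : gridAbove (ε n) s.toNNReal ≤ (q + 1) * T := by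
        calc gridAbove (ε n) s.toNNReal ≤ (((q + 1) * 2 ^ n : ℕ) : ℝ≥0) * ε n := by
              unfold gridAbove
              gcongr
          _ = (q + 1) * T := by
              simp only [hεdef]
              push_cast
              field_simp
      have h6 : (s.toNNReal : ℝ) ≤ (q + 1) * T := by exact_mod_cast (h3.trans_le h5).le
      rw [Real.coe_toNNReal _ hs.1] at h6
      exact h6.trans (mul_le_mul_of_nonneg_right h1 T.2)
    rw [Set.indicator_of_mem hu, Set.indicator_of_mem (show s ∈ Set.Icc 0 (D * T : ℝ) from
      ⟨hs.1, h2⟩)]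
    exact hf _
  have hbound : Integrable ((Set.Icc 0 (D * T : ℝ)).indicator (fun _ => (1 : ℝ))) :=
    (integrableOn_const (by simp)).integrable_indicator measurableSet_Icc
  have hD0 : 0 ≤ D * T := by positivity
  have hboundint : ∫ s, (Set.Icc 0 (D * T : ℝ)).indicator (fun _ => (1 : ℝ)) s = D * T := by
    rw [integral_indicator measurableSet_Icc]
    simp [hD0]
  have hlim : ∀ᵐ s : ℝ, Tendsto (fun n => φ n s) atTop (𝓝 (g s)) := by
    -- At the return time itself the limit is unclear, but a single point is null. An infinite
    -- return time is read as `0`, which is harmless.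
    have hne : ∀ᵐ s : ℝ, s ≠ (returnTime Z i₀ ω).toReal := by simp [ae_iff, measure_singleton]
    filter_upwards [hne] with s hs
    rcases lt_or_ge s 0 with hs0 | hs0
    · have h1 : ∀ n, φ n s = 0 := fun n => Set.indicator_of_notMem (fun h => hs0.not_ge h.1) _
      have h2 : g s = 0 := Set.indicator_of_notMem (fun h => hs0.not_ge h.1) _
      simp [h1, h2]
    have hcut : ∀ᶠ n in atTop, s ∈ Set.Ico 0 ((n * 2 ^ n : ℕ) * ε n : ℝ) := by
      have h1 : Tendsto (fun n : ℕ => (n : ℝ) * T) atTop atTop :=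
        tendsto_natCast_atTop_atTop.atTop_mul_const hT
      filter_upwards [h1.eventually_gt_atTop s] with n hn
      refine ⟨hs0, hn.trans_eq ?_⟩
      simp only [hεdef]
      push_cast
      field_simp
    -- The discretisation samples the grid point strictly after `s`, so right-continuity alone
    -- suffices.
    have hval : ∀ᶠ n in atTop, Z ((⌊s.toNNReal / ε n⌋₊ + 1 : ℕ) * ε n) ω = Z s.toNNReal ω :=
      (tendsto_gridAbove hε hε0 s.toNNReal).eventually (hr _)
    refine tendsto_const_nhds.congr' ?_
    by_cases hlt : ENNReal.ofReal s < returnTime Z i₀ ω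
    · filter_upwards [hcut, hval] with n h1 h2
      have h3 := mem_unreturned_of_lt_returnTime hr (hε n) hlt
      simp only [hφ, hg, hc]
      rw [Set.indicator_of_mem h1, Set.indicator_of_mem h3,
        Set.indicator_of_mem (show s ∈ excursion Z i₀ ω from ⟨hs0, hlt⟩), h2]
    · have hgt : returnTime Z i₀ ω < s.toNNReal := by
        refine lt_of_le_of_ne (not_lt.1 hlt) fun h => hs ?_
        rw [h]
        simp [hs0]
      filter_upwards [eventually_notMem_unreturned hr hε hε0 hgt] with n h1
      simp only [hφ, hg, hc]
      rw [Set.indicator_of_notMem (fun h : s ∈ excursion Z i₀ ω => hlt h.2)]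
      by_cases h2 : s ∈ Set.Ico 0 ((n * 2 ^ n : ℕ) * ε n : ℝ)
      · rw [Set.indicator_of_mem h2, Set.indicator_of_notMem h1]
      · rw [Set.indicator_of_notMem h2]
  refine ⟨?_, ?_, fun n => ?_⟩
  · rw [← integrable_indicator_iff (measurableSet_excursion Z i₀ ω)]
    refine hbound.mono' (aestronglyMeasurable_of_tendsto_ae atTop hφm hlim) ?_
    filter_upwards [hlim] with s hs
    exact le_of_tendsto hs.norm (Eventually.of_forall fun n => hφle n s)
  · rw [← integral_indicator (measurableSet_excursion Z i₀ ω)]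
    exact (tendsto_integral_of_dominated_convergence _ hφm hbound
      (fun n => ae_of_all _ (hφle n)) hlim).congr hφint
  · rw [← hφint, ← hboundint]
    exact norm_integral_le_of_norm_le hbound (ae_of_all _ (hφle n))

end Pathwise

/-! ### Uniform bounds from ergodicity. -/

section Ergodic

variable {S : Type*} [Fintype S] [DecidableEq S]

theorem IsExponentiallyErgodic.tendsto_transition {Q : Matrix S S ℝ} {π : S → ℝ}
    (herg : IsExponentiallyErgodic Q π) (x y : S) :
    Tendsto (fun t => transition Q t x y) atTop (𝓝 (π y)) := by
  obtain ⟨c, hc, h⟩ := herg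
  rw [tendsto_iff_norm_sub_tendsto_zero]
  refine squeeze_zero' (Eventually.of_forall fun t => norm_nonneg _) ?_ (h x)
  filter_upwards [eventually_ge_atTop 0] with t ht
  have h1 : |transition Q t x y - π y| ≤ ∑ k, |transition Q t x k - π k| :=
    Finset.single_le_sum (f := fun k => |transition Q t x k - π k|)
      (fun _ _ => abs_nonneg _) (Finset.mem_univ y)
  have h2 : 1 ≤ Real.exp (c * t) := Real.one_le_exp (by positivity)
  have h3 : 0 ≤ ∑ k, |transition Q t x k - π k| := by positivity
  rw [Real.norm_eq_abs]
  nlinarith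

theorem IsExponentiallyErgodic.exists_uniform_bounds {Q : Matrix S S ℝ} {π : S → ℝ}
    (herg : IsExponentiallyErgodic Q π) {i i₀ : S} (hi : π i < 1) (hi₀ : 0 < π i₀) :
    ∃ T : ℝ≥0, 0 < T ∧ ∃ r : ℝ, 0 ≤ r ∧ r < 1 ∧
      ∀ x, transition Q T x i ≤ r ∧ 1 - transition Q T x i₀ ≤ r := by
  -- The last two numbers lie strictly between `1` and the limits `π i` and `1 - π i₀`, so a single
  -- large time works for the finitely many starting states.
  set r : ℝ := max 0 (max ((1 + π i) / 2) (1 - π i₀ / 2)) with hr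
  have h1 : π i < r := by
    refine lt_of_lt_of_le ?_ ((le_max_left ((1 + π i) / 2) (1 - π i₀ / 2)).trans (le_max_right _ _))
    linarith
  have h2 : 1 - π i₀ < r := by
    refine lt_of_lt_of_le ?_
      ((le_max_right ((1 + π i) / 2) (1 - π i₀ / 2)).trans (le_max_right _ _))
    linarith
  have h3 : ∀ᶠ t : ℝ in atTop, ∀ x, transition Q t x i ≤ r ∧ 1 - transition Q t x i₀ ≤ r := by
    refine eventually_all.2 fun x => ?_
    have h4 := herg.tendsto_transition x i
    have h5 := (herg.tendsto_transition x i₀).const_sub 1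
    filter_upwards [h4.eventually_lt_const h1, h5.eventually_lt_const h2] with t h6 h7
    exact ⟨h6.le, h7.le⟩
  obtain ⟨t, ht, ht0⟩ := (h3.and (eventually_gt_atTop 0)).exists
  refine ⟨⟨t, ht0.le⟩, ht0, r, le_max_left _ _, ?_, ht⟩
  refine max_lt one_pos (max_lt ?_ ?_) <;> linarith

end Ergodic

/-! ### Integrability of the return time and Dynkin's formula. -/

section Expectation

theorem summable_of_antitone_of_le_pow {q : ℕ → ℝ} (hq0 : ∀ n, 0 ≤ q n) (hq : Antitone q) {c r : ℝ}
    (hr : 0 ≤ r) (hr1 : r < 1) (h : ∀ n, q (n + n) ≤ c * r ^ n) : Summable q := by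
  have hgeo : Summable fun n : ℕ => c * r ^ n :=
    (summable_geometric_of_lt_one hr hr1).mul_left c
  have heven : Summable fun n : ℕ => q (2 * n) := by
    refine Summable.of_nonneg_of_le (fun _ => hq0 _) (fun n => ?_) hgeo
    rw [two_mul n]
    exact h n
  have hodd : Summable fun n : ℕ => q (2 * n + 1) :=
    Summable.of_nonneg_of_le (fun _ => hq0 _) (fun n => hq (Nat.le_succ _)) heven
  exact (heven.hasSum.even_add_odd hodd.hasSum).summable

variable {Ω : Type*} {m : MeasurableSpace Ω} {P : Measure Ω}
  {ℱ : Filtration ℝ≥0 m} {S : Type*} [Fintype S] [DecidableEq S] [MeasurableSpace S]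
  [MeasurableSingletonClass S] {Q : Matrix S S ℝ} {Z : ℝ≥0 → Ω → S}

theorem IsMarkovChain.measurableSet_unreturned (hZ : IsMarkovChain P ℱ Q Z) (i₀ : S) (ε : ℝ≥0)
    (j : ℕ) : MeasurableSet[ℱ (j * ε)] (unreturned Z i₀ ε j) := by
  have e : unreturned Z i₀ ε j = ⋂ (l : ℕ) (p : ℕ) (_ : l ≤ p) (_ : p ≤ j),
      (((fun ω => (Z (l * ε) ω, Z 0 ω)) ⁻¹' {q | q.1 = q.2}) ∪ (Z (p * ε) ⁻¹' {i₀}ᶜ)) := by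
    ext ω
    simp only [unreturned, Set.mem_ofPred_eq, Set.mem_iInter, Set.mem_union, Set.mem_preimage,
      Set.mem_compl_iff, Set.mem_singleton_iff]
    refine forall_congr' fun l => forall_congr' fun p => forall_congr' fun _ =>
      forall_congr' fun _ => ?_
    exact or_iff_not_imp_left.symm
  rw [e]
  refine MeasurableSet.iInter fun l => MeasurableSet.iInter fun p => MeasurableSet.iInter fun hl =>
    MeasurableSet.iInter fun hp => ?_
  have hp' : (p : ℝ≥0) * ε ≤ j * ε := by gcongr
  have hl' : (l : ℝ≥0) * ε ≤ j * ε := by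
    have := hl.trans hp
    gcongr
  refine MeasurableSet.union ?_ ?_
  · exact ((hZ.measurable_of_le hl').prodMk (hZ.measurable_of_le zero_le))
      (Set.toFinite _).measurableSet
  · exact hZ.measurable_of_le hp' (measurableSet_singleton i₀).compl

theorem IsMarkovChain.measurable_lifetime (hZ : IsMarkovChain P ℱ Q Z) (i₀ : S) (ε : ℝ≥0) :
    Measurable (lifetime Z i₀ ε) :=
  Measurable.tsum fun j =>
    measurable_const.indicator (ℱ.le _ _ (hZ.measurableSet_unreturned i₀ ε j))

variable [IsProbabilityMeasure P]

/-- The probability that the chain observed on a grid stays in a set decays geometrically. -/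
theorem IsMarkovChain.measureReal_stay_le (hZ : IsMarkovChain P ℱ Q Z) {T : ℝ≥0} {C : Set S}
    {r : ℝ} (hr : 0 ≤ r) (hC : ∀ x, (transition Q T *ᵥ C.indicator 1) x ≤ r) (N M : ℕ) :
    P.real {ω | ∀ j, N < j → j ≤ N + M → Z (j * T) ω ∈ C} ≤ r ^ M := by
  induction M with
  | zero => simp
  | succ M ih =>
    set A : Set Ω := {ω | ∀ j, N < j → j ≤ N + M → Z (j * T) ω ∈ C} with hA
    have hCm : MeasurableSet C := (Set.toFinite C).measurableSet
    have hAm : MeasurableSet[ℱ ((N + M : ℕ) * T)] A := by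
      have e : A = ⋂ (j : ℕ) (_ : N < j) (_ : j ≤ N + M), Z (j * T) ⁻¹' C := by
        ext ω; simp [hA]
      rw [e]
      refine MeasurableSet.iInter fun j => MeasurableSet.iInter fun _ =>
        MeasurableSet.iInter fun hj => hZ.measurable_of_le ?_ hCm
      gcongr
    have hAm' := ℱ.le _ _ hAm
    have e1 : ((N + (M + 1) : ℕ) : ℝ≥0) * T = (N + M : ℕ) * T + T := by push_cast; ring
    have hsub : {ω | ∀ j, N < j → j ≤ N + (M + 1) → Z (j * T) ω ∈ C}
        ⊆ A ∩ Z ((N + M : ℕ) * T + T) ⁻¹' C := by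
      intro ω hω
      refine ⟨fun j h1 h2 => hω j h1 (by omega), ?_⟩
      have := hω (N + (M + 1)) (by omega) le_rfl
      rwa [e1] at this
    calc _ ≤ P.real (A ∩ Z ((N + M : ℕ) * T + T) ⁻¹' C) := measureReal_mono hsub
      _ = ∫ ω in A, C.indicator (1 : S → ℝ) (Z ((N + M : ℕ) * T + T) ω) ∂P := by
          have e2 : (fun ω => C.indicator (1 : S → ℝ) (Z ((N + M : ℕ) * T + T) ω))
              = (Z ((N + M : ℕ) * T + T) ⁻¹' C).indicator 1 := by
            funext ω; rfl
          rw [e2, integral_indicator_one (hZ.measurable _ hCm),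
            measureReal_restrict_apply (hZ.measurable _ hCm), Set.inter_comm]
      _ = ∫ ω in A, (transition Q T *ᵥ C.indicator 1) (Z ((N + M : ℕ) * T) ω) ∂P :=
          hZ.setIntegral_comp _ T _ hAm
      _ ≤ ∫ ω in A, r ∂P := by
          refine setIntegral_mono ?_ (integrable_const r) (fun ω => hC _)
          exact (hZ.integrable_comp _ _).integrableOn
      _ = P.real A * r := by simp
      _ ≤ r ^ M * r := mul_le_mul_of_nonneg_right ih hr
      _ = _ := (pow_succ _ _).symm

/-- Without an observed return by index `2N`, the chain either sits in `i` at all of the first `N`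
grid times or avoids `i₀` at all of the next `N`. Each alternative has probability at most `r ^ N`.
-/
theorem IsMarkovChain.measureReal_inter_unreturned_le (hZ : IsMarkovChain P ℱ Q Z)
    (hQ : IsGenerator Q) {i i₀ : S} {T : ℝ≥0} {r : ℝ} (hr : 0 ≤ r)
    (hT : ∀ x, transition Q T x i ≤ r ∧ 1 - transition Q T x i₀ ≤ r) (N : ℕ) :
    P.real (Z 0 ⁻¹' {i} ∩ unreturned Z i₀ T (N + N)) ≤ 2 * r ^ N := by
  have h1 : ∀ x, (transition Q T *ᵥ ({i} : Set S).indicator 1) x ≤ r := by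
    intro x
    refine le_trans (le_of_eq ?_) (hT x).1
    simp [Matrix.mulVec, dotProduct, Set.indicator_apply]
  have h2 : ∀ x, (transition Q T *ᵥ ({i₀}ᶜ : Set S).indicator 1) x ≤ r := by
    intro x
    refine le_trans (le_of_eq ?_) (hT x).2
    rw [← sum_transition_eq_one hQ T x]
    have e : ∀ y, ({i₀}ᶜ : Set S).indicator (1 : S → ℝ) y = 1 - if y = i₀ then 1 else 0 := by
      intro y
      by_cases h : y = i₀ <;> simp [h]
    simp [Matrix.mulVec, dotProduct, e, mul_sub]
  have h3 := hZ.measureReal_stay_le hr h1 0 N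
  have h4 := hZ.measureReal_stay_le hr h2 N N
  refine (measureReal_mono (s₂ := {ω | ∀ j : ℕ, 0 < j → j ≤ 0 + N → Z (j * T) ω ∈ ({i} : Set S)} ∪
    {ω | ∀ j : ℕ, N < j → j ≤ N + N → Z (j * T) ω ∈ ({i₀}ᶜ : Set S)}) ?_).trans
    ((measureReal_union_le _ _).trans (by linarith))
  rintro ω ⟨hωi, hωu⟩
  rw [Set.mem_union, or_iff_not_imp_left]
  intro h j hj1 hj2
  simp only [Set.mem_ofPred_eq, not_forall] at h
  obtain ⟨l, hl0, hlN, hl⟩ := h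
  refine hωu l j (by omega) hj2 ?_
  have : Z 0 ω = i := hωi
  rw [this]
  exact hl

theorem IsMarkovChain.summable_measureReal_inter_unreturned (hZ : IsMarkovChain P ℱ Q Z)
    (hQ : IsGenerator Q) {i i₀ : S} {T : ℝ≥0} {r : ℝ} (hr : 0 ≤ r) (hr1 : r < 1)
    (hT : ∀ x, transition Q T x i ≤ r ∧ 1 - transition Q T x i₀ ≤ r) :
    Summable fun j : ℕ => P.real (Z 0 ⁻¹' {i} ∩ unreturned Z i₀ T j) :=
  summable_of_antitone_of_le_pow (fun _ => measureReal_nonneg)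
    (fun _ _ hab => measureReal_mono
      (Set.inter_subset_inter_right _ (unreturned_antitone T hab)))
    hr hr1 (hZ.measureReal_inter_unreturned_le hQ hr hT)

theorem IsMarkovChain.setLIntegral_lifetime_ne_top (hZ : IsMarkovChain P ℱ Q Z)
    (hQ : IsGenerator Q) {i i₀ : S} {T : ℝ≥0} {r : ℝ} (hr : 0 ≤ r) (hr1 : r < 1)
    (hT : ∀ x, transition Q T x i ≤ r ∧ 1 - transition Q T x i₀ ≤ r) :
    ∫⁻ ω in Z 0 ⁻¹' {i}, lifetime Z i₀ T ω ∂P ≠ ⊤ := by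
  have hUm : ∀ j, MeasurableSet (unreturned Z i₀ T j) := fun j =>
    ℱ.le _ _ (hZ.measurableSet_unreturned i₀ T j)
  have hAm : MeasurableSet (Z 0 ⁻¹' {i}) := hZ.measurable 0 (measurableSet_singleton i)
  have e1 : ∫⁻ ω in Z 0 ⁻¹' {i}, lifetime Z i₀ T ω ∂P
      = ∑' j, ENNReal.ofReal (P.real (Z 0 ⁻¹' {i} ∩ unreturned Z i₀ T j)) := by
    unfold lifetime
    rw [lintegral_tsum fun j => (measurable_const.indicator (hUm j)).aemeasurable]
    refine tsum_congr fun j => ?_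
    rw [lintegral_indicator_const (hUm j), one_mul, Measure.restrict_apply (hUm j), Set.inter_comm,
      ofReal_measureReal]
  rw [e1]
  exact (hZ.summable_measureReal_inter_unreturned hQ hr hr1 hT).tsum_ofReal_ne_top

/-- Dynkin's formula on a grid: expectation of the discretised excursion integral. -/
theorem IsMarkovChain.exists_abs_integral_gridIntegral_sub_le (hZ : IsMarkovChain P ℱ Q Z)
    {f G : S → ℝ} {i₀ : S} (hG : Q *ᵥ G = fun x => - f x) (hG0 : G i₀ = 0) (i : S) :
    ∃ C : ℝ, 0 ≤ C ∧ ∀ ε : ℝ≥0, ε ≤ 1 → ∀ N : ℕ,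
      |∫ ω in Z 0 ⁻¹' {i}, gridIntegral Z f i₀ ε N ω ∂P - P.real (Z 0 ⁻¹' {i}) * G i|
        ≤ C * P.real (Z 0 ⁻¹' {i} ∩ unreturned Z i₀ ε N) + N * (C * ε ^ 2) := by
  obtain ⟨C1, hC10, hC1⟩ := exists_abs_transition_mulVec_sub_le Q G
  obtain ⟨C2, hC20, hC2⟩ := exists_abs_transition_mulVec_sub_self_le Q f
  obtain ⟨M, hM0, hM⟩ := exists_abs_le_of_finite G
  refine ⟨M + (C1 + C2), by positivity, fun ε hε N => ?_⟩
  have hε1 : (ε : ℝ) ≤ 1 := by exact_mod_cast hε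
  have hεI : (ε : ℝ) ∈ Set.Icc (0 : ℝ) 1 := ⟨ε.2, hε1⟩
  set A := Z 0 ⁻¹' {i} with hA
  have hAm0 : MeasurableSet[ℱ 0] A := hZ.adapted 0 (measurableSet_singleton i)
  have hAm : MeasurableSet A := ℱ.le _ _ hAm0
  have hAUm : ∀ j : ℕ, MeasurableSet[ℱ (j * ε)] (A ∩ unreturned Z i₀ ε j) := fun j =>
    (ℱ.mono zero_le _ hAm0).inter (hZ.measurableSet_unreturned i₀ ε j)
  have hUm : ∀ j, MeasurableSet (unreturned Z i₀ ε j) := fun j =>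
    ℱ.le _ _ (hZ.measurableSet_unreturned i₀ ε j)
  have hAUm' : ∀ j : ℕ, MeasurableSet (A ∩ unreturned Z i₀ ε j) := fun j => hAm.inter (hUm j)
  have hint : ∀ (g : S → ℝ) (t : ℝ≥0) (B : Set Ω), IntegrableOn (fun ω => g (Z t ω)) B P :=
    fun g t B => (hZ.integrable_comp g t).integrableOn
  set a : ℕ → ℝ := fun j => ∫ ω in A ∩ unreturned Z i₀ ε j, G (Z (j * ε) ω) ∂P with ha
  set d : ℕ → ℝ := fun j => ∫ ω in A ∩ unreturned Z i₀ ε j, f (Z ((j + 1 : ℕ) * ε) ω) ∂P with hd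
  have e1 : ∀ j : ℕ, ((j + 1 : ℕ) : ℝ≥0) * ε = j * ε + ε := fun j => by push_cast; ring
  have hstep : ∀ j, |a (j + 1) - a j + ε * d j| ≤ (C1 + C2) * ε ^ 2 := by
    intro j
    have h1 : a (j + 1) = ∫ ω in A ∩ unreturned Z i₀ ε j, G (Z (j * ε + ε) ω) ∂P := by
      simp only [ha, e1]
      -- The paths lost between `j` and `j + 1` are in `i₀`, where `G` vanishes, so the integral may
      -- be taken over the earlier event, which belongs to the past of `j * ε`.
      refine (setIntegral_eq_of_subset_of_forall_sdiff_eq_zero (hAUm' j)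
        (Set.inter_subset_inter_right _ (unreturned_antitone ε (Nat.le_succ j))) ?_).symm
      rintro ω ⟨⟨hωA, hω1⟩, hω2⟩
      have := eq_of_mem_unreturned_of_notMem hω1 fun h => hω2 ⟨hωA, h⟩
      rw [e1] at this
      rw [this, hG0]
    rw [h1, ha, hd]
    simp only [e1]
    rw [hZ.setIntegral_comp (j * ε) ε G (hAUm j), hZ.setIntegral_comp (j * ε) ε f (hAUm j),
      ← integral_sub (hint _ _ _) (hint _ _ _), ← integral_const_mul]
    have hsub : IntegrableOn (fun ω => (transition Q ε *ᵥ G) (Z (j * ε) ω) - G (Z (j * ε) ω))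
        (A ∩ unreturned Z i₀ ε j) P := (hint _ _ _).sub (hint _ _ _)
    rw [← integral_add hsub ((hint _ _ _).const_mul _)]
    have hle : ∀ x, |(transition Q ε *ᵥ G) x - G x + ε * (transition Q ε *ᵥ f) x|
        ≤ (C1 + C2) * ε ^ 2 := by
      intro x
      have h2 := hC1 ε hεI x
      have h3 := hC2 ε hεI x
      rw [hG] at h2
      simp only at h2
      have h4 : |ε * ((transition Q ε *ᵥ f) x - f x)| ≤ ε * (C2 * ε) := by
        rw [abs_mul, abs_of_nonneg ε.coe_nonneg]
        exact mul_le_mul_of_nonneg_left h3 ε.2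
      -- The drift of `G` over one step is `-ε f` up to `C1 * ε ^ 2`; evaluating `f` one step later
      -- costs `ε * (C2 * ε)`.
      calc _ = |((transition Q ε *ᵥ G) x - G x - ε * -f x)
            + ε * ((transition Q ε *ᵥ f) x - f x)| := by congr 1; ring
        _ ≤ C1 * ε ^ 2 + ε * (C2 * ε) := (abs_add_le _ _).trans (add_le_add h2 h4)
        _ = _ := by ring
    refine (norm_integral_le_of_norm_le_const (C := (C1 + C2) * ε ^ 2)
      (f := fun ω => (transition Q ε *ᵥ G) (Z (j * ε) ω) - G (Z (j * ε) ω)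
        + ε * (transition Q ε *ᵥ f) (Z (j * ε) ω)) (ae_of_all _ fun ω => hle _)).trans ?_
    exact mul_le_of_le_one_right (by positivity) (by simp)
  have hsum : |a N - a 0 + ∑ j ∈ Finset.range N, ε * d j| ≤ N * ((C1 + C2) * ε ^ 2) := by
    rw [← Finset.sum_range_sub a N, ← Finset.sum_add_distrib]
    refine (Finset.abs_sum_le_sum_abs _ _).trans ?_
    calc _ ≤ ∑ _j ∈ Finset.range N, (C1 + C2) * (ε : ℝ) ^ 2 :=
          Finset.sum_le_sum fun j _ => hstep j
      _ = _ := by simp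
  have hgrid : ∫ ω in A, gridIntegral Z f i₀ ε N ω ∂P = ∑ j ∈ Finset.range N, ε * d j := by
    unfold gridIntegral
    rw [integral_finsetSum _ fun j _ => ((hint f _ A).indicator (hUm j)).const_mul _]
    refine Finset.sum_congr rfl fun j _ => ?_
    rw [integral_const_mul, integral_indicator (hUm j), Measure.restrict_restrict (hUm j),
      Set.inter_comm]
  have ha0 : a 0 = P.real A * G i := by
    have h1 : a 0 = ∫ ω in A, G i ∂P := by
      simp only [ha, unreturned_zero, Set.inter_univ]
      refine setIntegral_congr_fun hAm fun ω hω => ?_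
      have : Z 0 ω = i := hω
      simp [this]
    rw [h1]
    simp
  have haN : |a N| ≤ M * P.real (A ∩ unreturned Z i₀ ε N) := by
    have := norm_setIntegral_le_of_norm_le_const (μ := P) (s := A ∩ unreturned Z i₀ ε N)
      (f := fun ω => G (Z (N * ε) ω)) (C := M) (measure_lt_top _ _) fun ω _ => hM _
    exact this
  rw [hgrid, ← ha0]
  have h5 : 0 ≤ (C1 + C2) * P.real (A ∩ unreturned Z i₀ ε N) := by positivity
  have h6 : 0 ≤ N * (M * (ε : ℝ) ^ 2) := by positivity
  calc |∑ j ∈ Finset.range N, ε * d j - a 0|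
      = |(a N - a 0 + ∑ j ∈ Finset.range N, ε * d j) - a N| := by congr 1; ring
    _ ≤ _ := abs_sub _ _
    _ ≤ N * ((C1 + C2) * ε ^ 2) + M * P.real (A ∩ unreturned Z i₀ ε N) := add_le_add hsum haN
    _ ≤ _ := by nlinarith

/-- The excursion integrals are absolutely convergent, and their expectations solve the Poisson
equation. -/
theorem IsMarkovChain.excursion_expectation (hZ : IsMarkovChain P ℱ Q Z) (hQ : IsGenerator Q)
    {π : S → ℝ} (herg : IsExponentiallyErgodic Q π) {f G : S → ℝ} {i i₀ : S} (hi : π i < 1)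
    (hi₀ : 0 < π i₀) (hf : ∀ x, |f x| ≤ 1) (hG : Q *ᵥ G = fun x => - f x) (hG0 : G i₀ = 0) :
    (∀ᵐ ω ∂(P.restrict (Z 0 ⁻¹' {i})),
        IntegrableOn (fun s : ℝ => f (Z s.toNNReal ω)) (excursion Z i₀ ω)) ∧
      Integrable (fun ω => ∫ s in excursion Z i₀ ω, f (Z s.toNNReal ω))
        (P.restrict (Z 0 ⁻¹' {i})) ∧
      ∫ ω in Z 0 ⁻¹' {i}, (∫ s in excursion Z i₀ ω, f (Z s.toNNReal ω)) ∂P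
        = P.real (Z 0 ⁻¹' {i}) * G i := by
  obtain ⟨T, hT0, r, hr0, hr1, hT⟩ := herg.exists_uniform_bounds hi hi₀
  set A := Z 0 ⁻¹' {i} with hA
  have hLint := hZ.setLIntegral_lifetime_ne_top hQ hr0 hr1 hT
  have hLm : AEMeasurable (lifetime Z i₀ T) (P.restrict A) :=
    (hZ.measurable_lifetime i₀ T).aemeasurable
  have hLtop : ∀ᵐ ω ∂(P.restrict A), lifetime Z i₀ T ω ≠ ⊤ :=
    (ae_lt_top' hLm hLint).mono fun ω h => h.ne
  have hbound : Integrable (fun ω => (lifetime Z i₀ T ω).toReal * T) (P.restrict A) :=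
    (integrable_toReal_of_lintegral_ne_top hLm hLint).mul_const _
  have hgm : ∀ n : ℕ, AEStronglyMeasurable (gridIntegral Z f i₀ (T / 2 ^ n) (n * 2 ^ n))
      (P.restrict A) := by
    intro n
    refine (Finset.measurable_fun_sum _ fun j _ => Measurable.const_mul ?_ _).aestronglyMeasurable
    exact ((measurable_of_finite f).comp (hZ.measurable _)).indicator
      (ℱ.le _ _ (hZ.measurableSet_unreturned i₀ _ j))
  have hle : ∀ n : ℕ, ∀ᵐ ω ∂(P.restrict A),
      ‖gridIntegral Z f i₀ (T / 2 ^ n) (n * 2 ^ n) ω‖ ≤ (lifetime Z i₀ T ω).toReal * T := by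
    intro n
    filter_upwards [hLtop] with ω hω
    exact (excursion_integral_of_lifetime_ne_top (hZ.right_continuous ω) hT0 hω hf).2.2 n
  have hlim : ∀ᵐ ω ∂(P.restrict A), Tendsto
      (fun n : ℕ => gridIntegral Z f i₀ (T / 2 ^ n) (n * 2 ^ n) ω) atTop
        (𝓝 (∫ s in excursion Z i₀ ω, f (Z s.toNNReal ω))) := by
    filter_upwards [hLtop] with ω hω
    exact (excursion_integral_of_lifetime_ne_top (hZ.right_continuous ω) hT0 hω hf).2.1
  refine ⟨?_, ?_, ?_⟩
  · filter_upwards [hLtop] with ω hω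
    exact (excursion_integral_of_lifetime_ne_top (hZ.right_continuous ω) hT0 hω hf).1
  · refine hbound.mono' (aestronglyMeasurable_of_tendsto_ae atTop hgm hlim) ?_
    filter_upwards [hlim, ae_all_iff.2 hle] with ω h1 h2
    exact le_of_tendsto h1.norm (Eventually.of_forall h2)
  · refine tendsto_nhds_unique
      (tendsto_integral_of_dominated_convergence _ hgm hbound hle hlim) ?_
    obtain ⟨C, hC0, hC⟩ := hZ.exists_abs_integral_gridIntegral_sub_le hG hG0 i
    have hhalf : Tendsto (fun n : ℕ => (n : ℝ) * (1 / 2) ^ n) atTop (𝓝 0) :=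
      tendsto_self_mul_const_pow_of_lt_one (by norm_num) (by norm_num)
    have hpow : Tendsto (fun n : ℕ => ((1 : ℝ) / 2) ^ n) atTop (𝓝 0) :=
      tendsto_pow_atTop_nhds_zero_of_lt_one (by norm_num) (by norm_num)
    have hU : Tendsto (fun n => P.real (A ∩ unreturned Z i₀ T n)) atTop (𝓝 0) :=
      (hZ.summable_measureReal_inter_unreturned hQ hr0 hr1 hT).tendsto_atTop_zero
    -- With mesh `T / 2 ^ n` and `n * 2 ^ n` steps, the horizon `n T` grows while the summed
    -- quadratic errors are `C T² n / 2 ^ n`.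
    have herr : Tendsto (fun n : ℕ => C * P.real (A ∩ unreturned Z i₀ T n)
        + C * T ^ 2 * (n * (1 / 2) ^ n)) atTop (𝓝 0) := by
      simpa using (hU.const_mul C).add (hhalf.const_mul (C * (T : ℝ) ^ 2))
    rw [tendsto_iff_norm_sub_tendsto_zero]
    refine squeeze_zero' (Eventually.of_forall fun n => norm_nonneg _) ?_ herr
    have hsmall : ∀ᶠ n : ℕ in atTop, T / 2 ^ n ≤ 1 := by
      have := hpow.const_mul (T : ℝ)
      rw [mul_zero] at this
      filter_upwards [this.eventually_lt_const one_pos] with n hn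
      rw [← NNReal.coe_le_coe]
      push_cast
      rw [one_div, inv_pow, ← div_eq_mul_inv] at hn
      exact hn.le
    filter_upwards [hsmall] with n hn
    refine (hC _ hn (n * 2 ^ n)).trans (add_le_add ?_ (le_of_eq ?_))
    · refine mul_le_mul_of_nonneg_left (measureReal_mono ?_) hC0
      refine Set.inter_subset_inter_right _ ((unreturned_refine_subset T n _).trans ?_)
      rw [Nat.mul_div_cancel _ (by positivity)]
    · rw [one_div_pow]
      push_cast
      field_simp

end Expectation

/-! ### Point mass as stationary law. -/

section Degenerate

variable {Ω : Type*} {m : MeasurableSpace Ω} {P : Measure Ω} [IsProbabilityMeasure P]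
  {ℱ : Filtration ℝ≥0 m} {S : Type*} [Fintype S] [DecidableEq S] [MeasurableSpace S]
  [MeasurableSingletonClass S] {Q : Matrix S S ℝ} {Z : ℝ≥0 → Ω → S} {π : S → ℝ}

/-- A chain whose stationary initial law is a point mass is almost surely constant. -/
theorem IsMarkovChain.ae_forall_eq (hZ : IsMarkovChain P ℱ Q Z) (hπ : IsStationaryLaw Q π)
    (hZ0 : ∀ i, P.real (Z 0 ⁻¹' {i}) = π i) {i : S} (hi : π i = 1) :
    ∀ᵐ ω ∂P, ∀ t, Z t ω = i := by
  have hπ0 : ∀ x, x ≠ i → π x = 0 := by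
    intro x hx
    have hnn : ∀ y, 0 ≤ π y := fun y => hZ0 y ▸ measureReal_nonneg
    have h1 := hπ.2
    rw [← Finset.add_sum_erase _ _ (Finset.mem_univ i), hi] at h1
    have h2 := Finset.single_le_sum (f := π) (fun y _ => hnn y)
      (Finset.mem_erase.2 ⟨hx, Finset.mem_univ x⟩)
    exact le_antisymm (by linarith) (hnn x)
  -- Invariance of the point mass `π` under `P(t)`, read at `i`.
  have hii : ∀ t, transition Q t i i = 1 := by
    intro t
    have h1 := hπ.sum_mul_transition t i
    rw [Finset.sum_eq_single i (fun x _ hx => by rw [hπ0 x hx, zero_mul])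
      (fun h => absurd (Finset.mem_univ i) h), hi, one_mul] at h1
    exact h1
  have h0 : ∀ᵐ ω ∂P, Z 0 ω = i :=
    (prob_compl_eq_zero_iff (hZ.measurable 0 (measurableSet_singleton i))).2 (by
      have := hZ0 i
      rwa [hi, measureReal_def, ENNReal.toReal_eq_one_iff] at this)
  have ht : ∀ t, ∀ᵐ ω ∂P, Z t ω = i := by
    intro t
    have hm : MeasurableSet (Z t ⁻¹' {i}) := hZ.measurable t (measurableSet_singleton i)
    refine (prob_compl_eq_zero_iff hm).2 ((ENNReal.toReal_eq_one_iff _).1 ?_)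
    rw [← measureReal_def]
    have h1 := hZ.setIntegral_comp 0 t (({i} : Set S).indicator 1) MeasurableSet.univ
    rw [zero_add, setIntegral_univ, setIntegral_univ] at h1
    have h2 : (fun ω => ({i} : Set S).indicator (1 : S → ℝ) (Z t ω))
        = (Z t ⁻¹' {i}).indicator 1 := rfl
    rw [h2, integral_indicator_one hm] at h1
    rw [h1]
    have h3 : ∀ᵐ ω ∂P, (transition Q t *ᵥ ({i} : Set S).indicator 1) (Z 0 ω) = 1 := by
      filter_upwards [h0] with ω hω
      rw [hω]
      simp [Matrix.mulVec, dotProduct, Set.indicator_apply, hii]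
    rw [integral_congr_ae h3]
    simp
  -- Dyadic times form a countable set, so one null set serves for all of them; right-continuity
  -- extends the equality to every `t`.
  set ε : ℕ → ℝ≥0 := fun n => 2⁻¹ ^ n
  have hε : ∀ n, 0 < ε n := fun n => by positivity
  have hε0 : Tendsto ε atTop (𝓝 0) :=
    NNReal.tendsto_pow_atTop_nhds_zero_of_lt_one (by rw [← NNReal.coe_lt_coe]; norm_num)
  filter_upwards [ae_all_iff.2 fun n : ℕ => ae_all_iff.2 fun j : ℕ => ht (j * ε n)] with ω hω t
  obtain ⟨n, hn⟩ := ((tendsto_gridAbove hε hε0 t).eventually (hZ.right_continuous ω t)).exists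
  exact hn.symm.trans (hω n _)

end Degenerate

/-! ### Conditioning on the initial state. -/

section Conditional

variable {Ω : Type*} {m : MeasurableSpace Ω} {P : Measure Ω} {A : Set Ω}

theorem ae_cond_of_ae_restrict {p : Ω → Prop} (h : ∀ᵐ ω ∂(P.restrict A), p ω) :
    ∀ᵐ ω ∂(cond P A), p ω :=
  Measure.ae_smul_measure h _

theorem integrable_cond_of_integrableOn {X : Ω → ℝ} (h : IntegrableOn X A P) :
    Integrable X (cond P A) := by
  by_cases hA : P A = 0
  · rw [cond_eq_zero_of_meas_eq_zero hA]
    exact integrable_zero_measure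
  · exact Integrable.smul_measure h (ENNReal.inv_ne_top.2 hA)

/-- On a null event both sides are zero, so the states with `π i = 0` need no separate treatment in
the variance. -/
theorem integral_cond_mul_measureReal [IsFiniteMeasure P] (X : Ω → ℝ) :
    (∫ ω, X ω ∂(cond P A)) * P.real A = ∫ ω in A, X ω ∂P := by
  by_cases hA : P A = 0
  · rw [Measure.restrict_eq_zero.2 hA, measureReal_def, hA]
    simp
  · have h1 : P.real A ≠ 0 := by simpa [measureReal_eq_zero_iff] using hA
    rw [ProbabilityTheory.cond, integral_smul_measure, ENNReal.toReal_inv, smul_eq_mul,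
      ← measureReal_def]
    field_simp

end Conditional

end MarkovOccupation

/-! ### The main theorem. -/

open MarkovOccupation in
theorem proposition3p3 {Ω : Type*} {m : MeasurableSpace Ω} (P : Measure Ω) [IsProbabilityMeasure P]
    (ℱ : Filtration ℝ≥0 m)
    {S : Type*} [Fintype S] [DecidableEq S] [MeasurableSpace S] [MeasurableSingletonClass S]
    (Q : Matrix S S ℝ) (Z : ℝ≥0 → Ω → S) (π : S → ℝ) (h : ℕ → ℝ≥0)
    (hQ : MarkovOccupation.IsGenerator Q) (hirr : MarkovOccupation.IsIrreducible Q)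
    (hZ : MarkovOccupation.IsMarkovChain P ℱ Q Z)
    (hπ : MarkovOccupation.IsStationaryLaw Q π)
    (hZ0 : ∀ i, P.real (Z 0 ⁻¹' {i}) = π i)
    (herg : MarkovOccupation.IsExponentiallyErgodic Q π)
    (hT : Tendsto (fun n : ℕ => (n : ℝ) * (h n : ℝ)) atTop atTop)
    (hh : Tendsto (fun n : ℕ => (n : ℝ) * (h n : ℝ) ^ 2) atTop (𝓝 0))
    (i₀ k : S) (hi₀ : 0 < π i₀) :
    (∀ i, (∀ᵐ ω ∂(cond P (Z 0 ⁻¹' {i})), IntegrableOn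
          (MarkovOccupation.centredIndicator Z π k ω) (MarkovOccupation.excursion Z i₀ ω)) ∧
        Integrable (MarkovOccupation.excursionIntegral Z π i₀ k) (cond P (Z 0 ⁻¹' {i}))) ∧
      0 ≤ MarkovOccupation.asymptoticVariance P Z π i₀ k ∧
      TendstoInDistribution
        (fun (n : ℕ) (ω : Ω) => √((n : ℝ) * (h n : ℝ)) *
          (MarkovOccupation.occupationFrequency Z (h n) n k ω - π k))
        atTop (id : ℝ → ℝ) (fun _ => P)
        (gaussianReal 0 (MarkovOccupation.asymptoticVariance P Z π i₀ k).toNNReal) := by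
  have hπ0 : ∀ i, 0 ≤ π i := fun i => hZ0 i ▸ measureReal_nonneg
  have hπ1 : ∀ i, π i ≤ 1 := fun i => hZ0 i ▸ measureReal_le_one
  set f : S → ℝ := fun x => (if x = k then 1 else 0) - π k with hfdef
  have hf : ∀ x, |f x| ≤ 1 := by
    intro x
    rw [abs_le]
    simp only [hfdef]
    have := hπ0 k
    have := hπ1 k
    constructor <;> split_ifs <;> linarith
  have hπf : π ⬝ᵥ (fun x => - f x) = 0 := by
    simp [hfdef, dotProduct, mul_sub, Finset.sum_sub_distrib, ← Finset.sum_mul, hπ.2]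
  obtain ⟨g, hg⟩ := exists_mulVec_eq_of_dotProduct_eq_zero hirr hπ hπf
  -- Rows of `Q` sum to zero, so subtracting a constant keeps the Poisson equation and gives the
  -- boundary value `G i₀ = 0`.
  set G : S → ℝ := fun x => g x - g i₀ with hGdef
  have hG0 : G i₀ = 0 := by simp [hGdef]
  have hG : Q *ᵥ G = fun x => - f x := by
    rw [← hg]
    funext x
    simp [hGdef, Matrix.mulVec, dotProduct, mul_sub, Finset.sum_sub_distrib, ← Finset.sum_mul,
      hQ.row_sum]
  set μ : ℝ := ∑ i, π i * (f i * G i) with hμdef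
  obtain ⟨H, hH⟩ := exists_mulVec_eq_of_dotProduct_eq_zero hirr hπ
    (w := fun x => μ - f x * G x) (by
      simp only [dotProduct, mul_sub, Finset.sum_sub_distrib, ← Finset.sum_mul, hπ.2, one_mul]
      exact sub_self _)
  have hμ : 0 ≤ μ := by
    have h1 := sum_mul_mul_mulVec_nonpos hQ hπ hπ0 G
    rw [hG] at h1
    have h2 : ∑ i, π i * G i * -f i = - μ := by
      rw [hμdef, ← Finset.sum_neg_distrib]
      exact Finset.sum_congr rfl fun i _ => by ring
    linarith
  -- When `π i = 1` the chain never leaves `i` and the return time need not be finite, but the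
  -- integrand vanishes: `π k` is `1` or `0` according to whether `k = i`.
  have hpoint : ∀ i, π i = 1 → f i = 0 ∧ ∀ᵐ ω ∂P, ∀ s, centredIndicator Z π k ω s = 0 := by
    intro i hi
    have hae := hZ.ae_forall_eq hπ hZ0 hi
    have hfi : f i = 0 := by
      simp only [hfdef]
      by_cases hik : i = k
      · rw [if_pos hik, ← hik, hi, sub_self]
      · have h1 : P.real (Z 0 ⁻¹' {k}) = 0 := by
          rw [measureReal_eq_zero_iff]
          have h0 : P {ω | ¬ ∀ t, Z t ω = i} = 0 := ae_iff.1 hae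
          refine measure_mono_null ?_ h0
          intro ω hω hc
          exact hik ((hc 0).symm.trans hω)
        rw [if_neg hik, ← hZ0 k, h1, sub_self]
    refine ⟨hfi, ?_⟩
    filter_upwards [hae] with ω hω s
    have h2 : centredIndicator Z π k ω s = f (Z s.toNNReal ω) := rfl
    rw [h2, hω, hfi]
  have hvar : asymptoticVariance P Z π i₀ k = 2 * μ := by
    rw [asymptoticVariance, hμdef]
    congr 1
    refine Finset.sum_congr rfl fun i _ => ?_
    rcases (hπ1 i).lt_or_eq with hi | hi
    · have h1 := (hZ.excursion_expectation hQ herg hi hi₀ hf hG hG0).2.2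
      have h2 : F P Z π i₀ k i * π i = π i * G i := by
        rw [← hZ0 i, F, integral_cond_mul_measureReal]
        exact h1
      rw [mul_assoc, h2]
      simp only [hfdef]
      ring
    · have h1 := (hpoint i hi).1
      simp only [hfdef] at h1
      simp only [hfdef, h1]
      ring
  refine ⟨fun i => ?_, ?_, ?_⟩
  · rcases (hπ1 i).lt_or_eq with hi | hi
    · have h1 := hZ.excursion_expectation hQ herg hi hi₀ hf hG hG0
      exact ⟨ae_cond_of_ae_restrict h1.1, integrable_cond_of_integrableOn h1.2.1⟩
    · have h1 : ∀ᵐ ω ∂(cond P (Z 0 ⁻¹' {i})), ∀ s, centredIndicator Z π k ω s = 0 :=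
        ae_cond_of_ae_restrict (ae_restrict_of_ae (hpoint i hi).2)
      constructor
      · filter_upwards [h1] with ω hω
        rw [show centredIndicator Z π k ω = 0 from funext hω]
        exact integrable_zero _ _ _
      · refine (integrable_congr ?_).2 (integrable_zero Ω ℝ _)
        filter_upwards [h1] with ω hω
        simp [excursionIntegral, hω]
  · rw [hvar]
    positivity
  · rw [hvar]
    exact hZ.tendstoInDistribution_occupationFrequency hQ hf hG hH hμ hT hh
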